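/- Let $n \ge 8$ and $m = n + 7$. Consider any instance of the fair allocation problem with agents $N = \{1,\dots,n\}$ and goods $M = \{1,\dots,m\}$, in which each agent $i$ has an additive valuation $v_i : 2^M \to \mathbb{R}$, i.e. $v_i(S) = \sum_{g \in S} v_i(\{g\})$ for all $S \subseteq M$, with $v_i(\{g\}) \ge 0$ for every $g \in M$. An allocation is an ordered partition $A = \langle A_1,\dots,A_n\rangle$ of $M$ into $n$ pairwise disjoint, possibly empty bundles with union $M$. The maximin share of agent $i$ is $$\mu_i = \max_{A} \min_{1 \le j \le n} v_i(A_j),$$ where the maximum is over all allocations $A$. Then there exists an MMS allocation, i.e. an allocation $A$ with $v_i(A_i) \ge \mu_i$ for every agent $i \in N$. -/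

import Mathlib

/-- A fair-allocation instance with agents `Fin n` and goods `Fin m`: each agent `i` has a valuation
`val i` on sets of items which is additive (so the empty set is worth `0`) and non-negative on
every item. Agents are not assumed to agree in any way. -/
structure GoodsInstance (n m : ℕ) where
  val : Fin n → Finset (Fin m) → ℝ
  additive : ∀ (i : Fin n) (S : Finset (Fin m)), val i S = ∑ g ∈ S, val i {g}
  nonneg : ∀ (i : Fin n) (g : Fin m), 0 ≤ val i {g}

/-- An allocation: a partition of the items into `n` bundles, one for each agent. Bundles may be
empty. -/
structure Allocation (n m : ℕ) where
  bundle : Fin n → Finset (Fin m)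
  disjoint : ∀ i j : Fin n, i ≠ j → Disjoint (bundle i) (bundle j)
  cover : ∀ g : Fin m, ∃ i : Fin n, g ∈ bundle i

/-- The maximin share of agent `i`: the maximum over all allocations of the value to `i` of the
worst bundle. There are finitely many allocations, and at least one since `i` exists; so
supremum and infimum are attained, see `GoodsInstance.isGreatest_mms`. -/
noncomputable def GoodsInstance.mms {n m : ℕ} (I : GoodsInstance n m) (i : Fin n) : ℝ :=
  ⨆ A : Allocation n m, ⨅ j : Fin n, I.val i (A.bundle j)

/-- An allocation is an MMS allocation if every agent gets at least her maximin share. -/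
def GoodsInstance.IsMMSAllocation {n m : ℕ} (I : GoodsInstance n m) (A : Allocation n m) : Prop :=
  ∀ i : Fin n, I.mms i ≤ I.val i (A.bundle i)

theorem Allocation.bundle_injective {n m : ℕ} :
    Function.Injective (Allocation.bundle : Allocation n m → Fin n → Finset (Fin m)) := by
  rintro ⟨b, _, _⟩ ⟨b', _, _⟩ h
  cases h
  rfl

/-- The maximin share is a genuine maximum of minima. -/
theorem GoodsInstance.isGreatest_mms {n m : ℕ} (I : GoodsInstance n m) (i : Fin n) :
    IsGreatest {x : ℝ | ∃ A : Allocation n m, IsLeast (Set.range fun j => I.val i (A.bundle j)) x}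
      (I.mms i) := by
  classical
  have : Nonempty (Fin n) := ⟨i⟩
  have : Finite (Allocation n m) := Finite.of_injective _ Allocation.bundle_injective
  have : Nonempty (Allocation n m) := by
    refine ⟨⟨fun j => if j = i then Finset.univ else ∅, fun j k hjk => ?_, fun g => ⟨i, by simp⟩⟩⟩
    by_cases hj : j = i
    · have hk : k ≠ i := fun hk => hjk (hj.trans hk.symm)
      simp [hk]
    · simp [hj]
  have key : ∀ A : Allocation n m, IsLeast (Set.range fun j => I.val i (A.bundle j))
      (⨅ j : Fin n, I.val i (A.bundle j)) := fun A =>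
    ⟨Set.Nonempty.csInf_mem (Set.range_nonempty _) (Set.finite_range _),
      fun _ hx => csInf_le (Set.finite_range _).bddBelow hx⟩
  refine ⟨?_, ?_⟩
  · obtain ⟨A, hA⟩ := Set.Nonempty.csSup_mem
      (Set.range_nonempty fun A : Allocation n m => ⨅ j : Fin n, I.val i (A.bundle j))
      (Set.finite_range _)
    refine ⟨A, ?_⟩
    have h : I.mms i = ⨅ j : Fin n, I.val i (A.bundle j) := hA.symm
    rw [h]
    exact key A
  · rintro x ⟨A, hA⟩
    rw [hA.unique (key A)]
    exact le_ciSup (f := fun A : Allocation n m => ⨅ j : Fin n, I.val i (A.bundle j))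
      (Set.finite_range _).bddAbove A

/-! ### Ordered instances, domination and exchange of goods. -/

/-- Goods `0, 1, 2, …` which every agent `a` ranks in the same weakly decreasing order, together
with a threshold `mu a` that agent `a` wants her bundle to reach. -/
structure OrderedInstance (ι : Type*) where
  v : ι → ℕ → ℝ
  mu : ι → ℝ
  nonneg : ∀ a g, 0 ≤ v a g
  anti : ∀ a, Antitone (v a)

/-- `C` dominates `S`: the goods of `S` can be matched with goods of `C` that are at least as
good. -/
def Dominates (C S : Finset ℕ) : Prop :=
  ∃ φ : ℕ → ℕ, Set.InjOn φ S ∧ ∀ s ∈ S, φ s ∈ C ∧ φ s ≤ s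

namespace OrderedInstance

variable {ι : Type*} (I : OrderedInstance ι)

def val (a : ι) (S : Finset ℕ) : ℝ := ∑ g ∈ S, I.v a g

def Likes (a : ι) (S : Finset ℕ) : Prop := I.mu a ≤ I.val a S

/-- The agents of `A` can be given disjoint bundles from `G` that they like. -/
def Solvable (A : Finset ι) (G : Finset ℕ) : Prop :=
  ∃ f : ι → Finset ℕ, (∀ a ∈ A, f a ⊆ G ∧ I.Likes a (f a)) ∧ (A : Set ι).PairwiseDisjoint f

/-- The bundles `P j`, `j ∈ J`, are disjoint parts of `G` that `a` likes. -/
structure IsPacking (a : ι) (G J : Finset ℕ) (P : ℕ → Finset ℕ) : Prop where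
  sub : ∀ j ∈ J, P j ⊆ G
  disj : ∀ i ∈ J, ∀ j ∈ J, i ≠ j → Disjoint (P i) (P j)
  likes : ∀ j ∈ J, I.Likes a (P j)

/-- `a` can find `n` disjoint bundles in `G` that she likes, whose sizes exceed two by at most `E`
altogether. -/
def Split (a : ι) (n E : ℕ) (G : Finset ℕ) : Prop :=
  ∃ J P, I.IsPacking a G J P ∧ J.card = n ∧ ∑ j ∈ J, ((P j).card - 2) ≤ E

variable {I}

theorem val_mono {a : ι} {S T : Finset ℕ} (h : S ⊆ T) : I.val a S ≤ I.val a T :=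
  Finset.sum_le_sum_of_subset_of_nonneg h fun g _ _ => I.nonneg a g

theorem Likes.mono {a : ι} {S T : Finset ℕ} (hS : I.Likes a S) (h : S ⊆ T) : I.Likes a T :=
  le_trans hS (val_mono h)

theorem val_union {a : ι} {S T : Finset ℕ} (h : Disjoint S T) :
    I.val a (S ∪ T) = I.val a S + I.val a T := Finset.sum_union h

theorem val_sdiff {a : ι} {S T : Finset ℕ} (h : S ⊆ T) :
    I.val a (T \ S) = I.val a T - I.val a S := by
  have := Finset.sum_sdiff (f := I.v a) h
  unfold val
  linarith

theorem val_le_of_dominates {a : ι} {C S : Finset ℕ} (h : Dominates C S) :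
    I.val a S ≤ I.val a C := by
  obtain ⟨φ, hinj, hφ⟩ := h
  calc I.val a S ≤ ∑ s ∈ S, I.v a (φ s) := Finset.sum_le_sum fun s hs => I.anti a (hφ s hs).2
    _ = ∑ g ∈ S.image φ, I.v a g := (Finset.sum_image fun x hx y hy => hinj hx hy).symm
    _ ≤ I.val a C := val_mono (Finset.image_subset_iff.2 fun s hs => (hφ s hs).1)

theorem Likes.of_dominates {a : ι} {C S : Finset ℕ} (hS : I.Likes a S) (h : Dominates C S) :
    I.Likes a C := le_trans hS (val_le_of_dominates h)

theorem Solvable.mono {A : Finset ι} {G H : Finset ℕ} (h : I.Solvable A G) (hGH : G ⊆ H) :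
    I.Solvable A H := by
  obtain ⟨f, hf, hd⟩ := h
  exact ⟨f, fun a ha => ⟨(hf a ha).1.trans hGH, (hf a ha).2⟩, hd⟩

theorem Solvable.union [DecidableEq ι] {A B : Finset ι} {G H : Finset ℕ} (hA : I.Solvable A G)
    (hB : I.Solvable B H) (hGH : Disjoint G H) : I.Solvable (A ∪ B) (G ∪ H) := by
  obtain ⟨f, hf, hfd⟩ := hA
  obtain ⟨g, hg, hgd⟩ := hB
  refine ⟨fun a => if a ∈ A then f a else g a, fun a ha => ?_, fun a ha b hb hab => ?_⟩
  · by_cases h : a ∈ A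
    · simp only [h, if_true]
      exact ⟨(hf a h).1.trans Finset.subset_union_left, (hf a h).2⟩
    · have h' : a ∈ B := by simpa [h] using ha
      simp only [h, if_false]
      exact ⟨(hg a h').1.trans Finset.subset_union_right, (hg a h').2⟩
  · have ha' : a ∉ A → a ∈ B := fun h => by simpa [h] using ha
    have hb' : b ∉ A → b ∈ B := fun h => by simpa [h] using hb
    simp only [Function.onFun]
    by_cases h : a ∈ A <;> by_cases h' : b ∈ A <;> simp only [h, h', if_true, if_false]
    · exact hfd h h' hab
    · exact Finset.disjoint_of_subset_left (hf a h).1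
        (Finset.disjoint_of_subset_right (hg b (hb' h')).1 hGH)
    · exact Finset.disjoint_of_subset_left (hg a (ha' h)).1
        (Finset.disjoint_of_subset_right (hf b h').1 hGH.symm)
    · exact hgd (ha' h) (hb' h') hab

theorem solvable_singleton {a : ι} {S : Finset ℕ} (h : I.Likes a S) : I.Solvable {a} S :=
  ⟨fun _ => S, fun b hb => by
    rw [Finset.mem_singleton.1 hb]; exact ⟨subset_rfl, h⟩, by simp⟩

theorem Solvable.insert [DecidableEq ι] {a : ι} {A : Finset ι} {G S : Finset ℕ}
    (h : I.Solvable A (G \ S)) (hS : S ⊆ G) (ha : I.Likes a S) :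
    I.Solvable (insert a A) G := by
  have := (solvable_singleton ha).union h Finset.disjoint_sdiff
  rw [Finset.union_sdiff_of_subset hS] at this
  exact this

/-- Exchanging a good outside the bundles against a worse good of the bundles. -/
theorem IsPacking.swap {a : ι} {G J : Finset ℕ} {P : ℕ → Finset ℕ} (h : I.IsPacking a G J P)
    {c s : ℕ} (hc : c ∈ G) (hs : s ∈ G) (hcs : c ≤ s) (hcP : ∀ j ∈ J, c ∉ P j) :
    I.IsPacking a G J fun j => (P j).map (Equiv.swap c s).toEmbedding := by
  refine ⟨fun j hj x hx => ?_, fun i hi j hj hij => ?_, fun j hj => ?_⟩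
  · obtain ⟨y, hy, rfl⟩ := Finset.mem_map.1 hx
    have hyG := h.sub j hj hy
    simp only [Equiv.coe_toEmbedding, Equiv.swap_apply_def]
    split_ifs <;> assumption
  · exact (Finset.disjoint_map _).2 (h.disj i hi j hj hij)
  · refine le_trans (h.likes j hj) ?_
    unfold val
    rw [Finset.sum_map]
    refine Finset.sum_le_sum fun g hg => I.anti a ?_
    have hgc : g ≠ c := fun e => hcP j hj (e ▸ hg)
    simp only [Equiv.coe_toEmbedding, Equiv.swap_apply_def, hgc, if_false]
    split_ifs with e
    · exact e ▸ hcs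
    · exact le_rfl

/-- A set dominated by goods outside the bundles may be removed. -/
theorem IsPacking.remove_of_dominates {a : ι} {G J : Finset ℕ} {P : ℕ → Finset ℕ}
    (h : I.IsPacking a G J P) {C S : Finset ℕ} (hC : C ⊆ G) (hCP : ∀ j ∈ J, Disjoint C (P j))
    (hS : S ⊆ G) (hd : Dominates C S) :
    ∃ P', I.IsPacking a (G \ S) J P' ∧ ∀ j ∈ J, (P' j).card = (P j).card := by
  obtain ⟨φ, hinj, hφ⟩ := hd
  induction hk : (S.filter fun s => φ s ≠ s).card using Nat.strong_induction_on
    generalizing C P φ with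
  | _ k ih =>
  rcases (S.filter fun s => φ s ≠ s).eq_empty_or_nonempty with hE | hE
  · have hSC : S ⊆ C := fun s hs => by
      have : φ s = s := by
        by_contra hne
        exact Finset.notMem_empty s (hE ▸ Finset.mem_filter.2 ⟨hs, hne⟩)
      exact this ▸ (hφ s hs).1
    refine ⟨P, ⟨fun j hj x hx => Finset.mem_sdiff.2 ⟨h.sub j hj hx, fun hxS => ?_⟩,
      h.disj, h.likes⟩, fun _ _ => rfl⟩
    exact Finset.disjoint_left.1 (hCP j hj) (hSC hxS) hx
  -- For the least `s` that `φ` moves, `φ s` is outside `S`: otherwise it would be a smaller element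
  -- of `S`, and by injectivity `φ` would move it too. Each case below makes `s` a fixed point and
  -- moves no new element, so the induction applies.
  · obtain ⟨s, hs, hmin⟩ := Finset.exists_min_image _ id hE
    obtain ⟨hsS, hne⟩ := Finset.mem_filter.1 hs
    have hcC := (hφ s hsS).1
    have hcs : φ s < s := lt_of_le_of_ne (hφ s hsS).2 hne
    have hcS : φ s ∉ S := fun hcS => by
      have h1 : φ (φ s) ≠ φ s := fun e => hne (hinj hcS hsS e)
      exact absurd (hmin _ (Finset.mem_filter.2 ⟨hcS, h1⟩)) (by simpa using hcs)
    by_cases hsC : s ∈ C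
    · -- redirect `φ` so that it fixes `s`
      let ψ : ℕ → ℕ := fun x => if x = s then s else if φ x = s then φ s else φ x
      have hψs : ψ s = s := by simp [ψ]
      refine ih _ ?_ h hC hCP ψ ?_ ?_ rfl
      · rw [← hk]
        apply Finset.card_lt_card
        refine ⟨fun x hx => ?_, fun hsub => ?_⟩
        · obtain ⟨hxS, hxne⟩ := Finset.mem_filter.1 hx
          have hxs : x ≠ s := fun e => hxne (by rw [e, hψs])
          refine Finset.mem_filter.2 ⟨hxS, fun e => ?_⟩
          exact hxne (by simp [ψ, hxs, e])
        · have := hsub hs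
          exact (Finset.mem_filter.1 this).2 hψs
      · intro x hx y hy hxy
        simp only [ψ] at hxy
        have key : ∀ z ∈ S, z ≠ s → φ z ≠ φ s := fun z hz hzs e => hzs (hinj hz hsS e)
        split_ifs at hxy with h1 h2 h3 h4 h5 h6 h7 h8
        · rw [h1, h2]
        · exact absurd hxy.symm hne
        · exact absurd hxy.symm h3
        · exact absurd hxy hne
        · exact hinj hx hy (h4.trans h6.symm)
        · exact absurd hxy.symm (key y hy h5)
        · exact absurd hxy h4
        · exact absurd hxy (key x hx h1)
        · exact hinj hx hy hxy
      · intro x hx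
        simp only [ψ]
        split_ifs with h1 h2
        · exact ⟨hsC, h1.ge⟩
        · exact ⟨hcC, hcs.le.trans (h2.symm.le.trans (hφ x hx).2)⟩
        · exact hφ x hx
    · -- exchange `s` and `φ s`
      have hsw := h.swap (hC hcC) (hS hsS) hcs.le
        fun j hj hc => Finset.disjoint_left.1 (hCP j hj) hcC hc
      let ψ : ℕ → ℕ := fun x => if x = s then s else φ x
      have hψs : ψ s = s := by simp [ψ]
      have hmemC' : ∀ x, x ∈ C.map (Equiv.swap (φ s) s).toEmbedding ↔ x = s ∨ x ∈ C ∧ x ≠ φ s := by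
        intro x
        simp only [Finset.mem_map, Equiv.coe_toEmbedding]
        constructor
        · rintro ⟨y, hy, rfl⟩
          simp only [Equiv.swap_apply_def]
          split_ifs with h1 h2
          · exact Or.inl rfl
          · exact absurd (h2 ▸ hy) hsC
          · exact Or.inr ⟨hy, h1⟩
        · rintro (rfl | ⟨hx, hne'⟩)
          · exact ⟨φ x, hcC, by simp⟩
          · exact ⟨x, hx, Equiv.swap_apply_of_ne_of_ne hne' fun e => hsC (e ▸ hx)⟩
      obtain ⟨P', hP', hcard⟩ := ih _ (by
          rw [← hk]
          apply Finset.card_lt_card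
          refine ⟨fun x hx => ?_, fun hsub => ?_⟩
          · obtain ⟨hxS, hxne⟩ := Finset.mem_filter.1 hx
            have hxs : x ≠ s := fun e => hxne (by rw [e, hψs])
            refine Finset.mem_filter.2 ⟨hxS, fun e => hxne ?_⟩
            simp [ψ, hxs, e]
          · exact (Finset.mem_filter.1 (hsub hs)).2 hψs) hsw
        (C := C.map (Equiv.swap (φ s) s).toEmbedding)
        (fun x hx => by
          rcases (hmemC' x).1 hx with rfl | ⟨hx, _⟩
          · exact hS hsS
          · exact hC hx)
        (fun j hj => (Finset.disjoint_map _).2 (hCP j hj)) ψ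
        (by
          intro x hx y hy hxy
          simp only [ψ] at hxy
          split_ifs at hxy with h1 h2 h3
          · rw [h1, h2]
          · exact absurd (hxy ▸ (hφ y hy).1) hsC
          · exact absurd (hxy ▸ (hφ x hx).1) hsC
          · exact hinj hx hy hxy)
        (by
          intro x hx
          simp only [ψ]
          split_ifs with h1
          · exact ⟨(hmemC' _).2 (Or.inl rfl), h1.ge⟩
          · exact ⟨(hmemC' _).2 (Or.inr ⟨(hφ x hx).1, fun e => h1 (hinj hx hsS e)⟩),
              (hφ x hx).2⟩) rfl
      exact ⟨P', hP', fun j hj => by rw [hcard j hj, Finset.card_map]⟩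

end OrderedInstance

/-! ### Divisions into three bundles when no three agents can be satisfied. -/

theorem Dominates.of_triple {C : Finset ℕ} {a b c x y z : ℕ} (ha : a ∈ C) (hb : b ∈ C) (hc : c ∈ C)
    (hab : a ≠ b) (hac : a ≠ c) (hbc : b ≠ c) (hax : a ≤ x) (hby : b ≤ y) (hcz : c ≤ z)
    (hxy : x ≠ y) (hxz : x ≠ z) (hyz : y ≠ z) : Dominates C {x, y, z} := by
  refine ⟨fun s => if s = x then a else if s = y then b else c, ?_, ?_⟩
  · intro s hs t ht h
    simp only [Finset.coe_insert, Finset.coe_singleton, Set.mem_insert_iff,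
      Set.mem_singleton_iff] at hs ht
    dsimp only at h
    grind
  · intro s hs
    simp only [Finset.mem_insert, Finset.mem_singleton] at hs
    grind

theorem Dominates.mono {C D S : Finset ℕ} (h : Dominates C S) (hCD : C ⊆ D) : Dominates D S := by
  obtain ⟨φ, hi, hφ⟩ := h
  exact ⟨φ, hi, fun s hs => ⟨hCD (hφ s hs).1, (hφ s hs).2⟩⟩

theorem Fin.exists_others (j : Fin 3) :
    ∃ j₁ j₂, j₁ ≠ j ∧ j₂ ≠ j ∧ j₁ ≠ j₂ ∧ ∀ k, k = j ∨ k = j₁ ∨ k = j₂ := by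
  revert j; decide

namespace OrderedInstance

variable {ι : Type*} {I : OrderedInstance ι}

theorem solvable_three [DecidableEq ι] {a b c : ι} {S T U G : Finset ℕ}
    (hS : S ⊆ G) (hT : T ⊆ G) (hU : U ⊆ G) (hST : Disjoint S T) (hSU : Disjoint S U)
    (hTU : Disjoint T U) (ha : I.Likes a S) (hb : I.Likes b T) (hc : I.Likes c U) :
    I.Solvable {a, b, c} G := by
  have h := (solvable_singleton ha).union ((solvable_singleton hb).union (solvable_singleton hc) hTU)
    (Finset.disjoint_union_right.2 ⟨hST, hSU⟩)
  exact Solvable.mono h (Finset.union_subset hS (Finset.union_subset hT hU))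

theorem likes_or_likes_sdiff {a : ι} {X H : Finset ℕ} (hX : X ⊆ H) (h : 2 * I.mu a ≤ I.val a H) :
    I.Likes a X ∨ I.Likes a (H \ X) := by
  by_contra hcon
  rw [not_or] at hcon
  simp only [Likes, not_le, val_sdiff hX] at hcon
  linarith [hcon.1, hcon.2]

/-- A partition of `G` into three bundles that `a` likes. -/
structure IsDivision (I : OrderedInstance ι) (a : ι) (G : Finset ℕ) (P : Fin 3 → Finset ℕ) :
    Prop where
  biUnion_eq : Finset.univ.biUnion P = G
  disj : ∀ i j, i ≠ j → Disjoint (P i) (P j)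
  likes : ∀ j, I.Likes a (P j)

namespace IsDivision

variable {a : ι} {G : Finset ℕ} {P : Fin 3 → Finset ℕ} (h : I.IsDivision a G P)
include h

theorem sub (j : Fin 3) : P j ⊆ G := by
  rw [← h.biUnion_eq]
  exact Finset.subset_biUnion_of_mem P (Finset.mem_univ j)

theorem exists_mem {g : ℕ} (hg : g ∈ G) : ∃ j, g ∈ P j := by
  rw [← h.biUnion_eq] at hg
  simpa using hg

theorem val_eq (b : ι) : I.val b G = ∑ j, I.val b (P j) := by
  rw [← h.biUnion_eq]
  exact Finset.sum_biUnion fun i _ j _ hij => h.disj i j hij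

theorem card_eq : G.card = ∑ j, (P j).card := by
  rw [← h.biUnion_eq]
  exact Finset.card_biUnion fun i _ j _ hij => h.disj i j hij

theorem card_eq_inter {S : Finset ℕ} (hS : S ⊆ G) : S.card = ∑ j, (S ∩ P j).card := by
  rw [← Finset.card_biUnion fun i _ j _ hij =>
    (h.disj i j hij).mono Finset.inter_subset_right Finset.inter_subset_right]
  congr 1
  rw [← Finset.inter_biUnion, h.biUnion_eq, Finset.inter_eq_left.2 hS]

theorem three_mul_le : 3 * I.mu a ≤ I.val a G := by
  rw [h.val_eq, Fin.sum_univ_three]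
  have := h.likes 0
  have := h.likes 1
  have := h.likes 2
  simp only [Likes] at *
  linarith

theorem eq_of_mem {g : ℕ} {i j : Fin 3} (hi : g ∈ P i) (hj : g ∈ P j) : i = j := by
  by_contra hij
  exact Finset.disjoint_left.1 (h.disj i j hij) hi hj

end IsDivision

/-- Every agent of `A` has a division of `G`, but no three of them can be satisfied. Then for each
`a` the other agents like the bundle `P a (l a)` and no other bundle of `P a`. -/
structure IsStuck (I : OrderedInstance ι) (A : Finset ι) (G : Finset ℕ) (P : ι → Fin 3 → Finset ℕ)
    (l : ι → Fin 3) : Prop where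
  division : ∀ a ∈ A, I.IsDivision a G (P a)
  fail : ∀ X ⊆ A, X.card = 3 → ¬ I.Solvable X G
  likes_iff : ∀ a ∈ A, ∀ b ∈ A, b ≠ a → ∀ j, I.Likes b (P a j) ↔ j = l a
  exists_third : ∀ a b, ∃ c ∈ A, c ≠ a ∧ c ≠ b

/-- The three bundles of `a` are worth at least three thresholds to any other agent, so she likes
one of them. If two other agents liked different bundles, `a` could take the third one. Hence all
others agree, and comparison with a further agent shows that nobody but `a` likes a second bundle.
-/
theorem exists_isStuck {A : Finset ι} {G : Finset ℕ} {P : ι → Fin 3 → Finset ℕ}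
    (hA : 3 ≤ A.card) (hP : ∀ a ∈ A, I.IsDivision a G (P a))
    (hfail : ∀ X ⊆ A, X.card = 3 → ¬ I.Solvable X G) : ∃ l, I.IsStuck A G P l := by
  classical
  have third : ∀ a b, ∃ c ∈ A, c ≠ a ∧ c ≠ b := by
    intro a b
    by_contra hcon
    push Not at hcon
    have hsub : A ⊆ {a, b} := fun c hc => by
      by_cases h : c = a
      · simp [h]
      · simp [hcon c hc h]
    have := Finset.card_le_card hsub
    have := Finset.card_le_two (a := a) (b := b)
    omega
  have some_liked : ∀ a ∈ A, ∀ b ∈ A, ∃ j, I.Likes b (P a j) := by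
    intro a ha b hb
    by_contra hcon
    push Not at hcon
    have h1 := (hP b hb).three_mul_le
    rw [(hP a ha).val_eq, Fin.sum_univ_three] at h1
    have := hcon 0
    have := hcon 1
    have := hcon 2
    simp only [Likes, not_le] at *
    linarith
  have same : ∀ a ∈ A, ∀ b ∈ A, ∀ c ∈ A, b ≠ a → c ≠ a → b ≠ c → ∀ i j, I.Likes b (P a i) →
      I.Likes c (P a j) → i = j := by
    intro a ha b hb c hc hba hca hbc i j hi hj
    by_contra hij
    have hd := (hP a ha)
    obtain ⟨k, hki, hkj⟩ : ∃ k : Fin 3, k ≠ i ∧ k ≠ j := by exact (by decide : ∀ i j : Fin 3, ∃ k, k ≠ i ∧ k ≠ j) i j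
    refine hfail {a, b, c} ?_ ?_ (solvable_three (hd.sub k) (hd.sub i)
      (hd.sub j) (hd.disj k i hki) (hd.disj k j hkj) (hd.disj i j hij) (hd.likes k) hi hj)
    · intro x hx
      simp only [Finset.mem_insert, Finset.mem_singleton] at hx
      rcases hx with rfl | rfl | rfl <;> assumption
    · exact Finset.card_eq_three.2 ⟨a, b, c, hba.symm, hca.symm, hbc, rfl⟩
  have key : ∀ a, ∃ l, a ∈ A → ∀ b ∈ A, b ≠ a → ∀ j, I.Likes b (P a j) ↔ j = l := by
    intro a
    by_cases ha : a ∈ A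
    swap
    · exact ⟨0, fun h => absurd h ha⟩
    obtain ⟨b₀, hb₀, hba₀, -⟩ := third a a
    obtain ⟨l, hl⟩ := some_liked a ha b₀ hb₀
    have only : ∀ b ∈ A, b ≠ a → ∀ j, I.Likes b (P a j) → j = l := by
      intro b hb hba j hj
      by_cases hbb : b = b₀
      · obtain ⟨c, hc, hca, hcb⟩ := third a b
        obtain ⟨k, hk⟩ := some_liked a ha c hc
        rw [same a ha b hb c hc hba hca hcb.symm j k hj hk,
          same a ha b hb c hc hba hca hcb.symm l k (hbb ▸ hl) hk]
      · exact same a ha b hb b₀ hb₀ hba hba₀ hbb j l hj hl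
    refine ⟨l, fun _ b hb hba j => ⟨only b hb hba j, ?_⟩⟩
    rintro rfl
    obtain ⟨k, hk⟩ := some_liked a ha b hb
    exact only b hb hba k hk ▸ hk
  choose l hl using key
  exact ⟨l, hP, hfail, fun a ha => hl a ha, third⟩

namespace IsStuck

variable {A : Finset ι} {G : Finset ℕ} {P : ι → Fin 3 → Finset ℕ} {l : ι → Fin 3}
  (h : I.IsStuck A G P l)
include h

theorem false_of_three {a b c : ι} {S T U : Finset ℕ} (ha : a ∈ A) (hb : b ∈ A) (hc : c ∈ A)
    (hab : a ≠ b) (hac : a ≠ c) (hbc : b ≠ c)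
    (hS : S ⊆ G) (hT : T ⊆ G) (hU : U ⊆ G) (hST : Disjoint S T) (hSU : Disjoint S U)
    (hTU : Disjoint T U) (hla : I.Likes a S) (hlb : I.Likes b T) (hlc : I.Likes c U) : False := by
  classical
  refine h.fail {a, b, c} ?_ (Finset.card_eq_three.2 ⟨a, b, c, hab, hac, hbc, rfl⟩)
    (solvable_three hS hT hU hST hSU hTU hla hlb hlc)
  intro x hx
  simp only [Finset.mem_insert, Finset.mem_singleton] at hx
  rcases hx with rfl | rfl | rfl <;> assumption

/-- Cut and choose with a spare bundle: one agent takes `P a j`, `b` cuts the rest, and a third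
agent who values the rest at two thresholds chooses. If the others like `P a j`, one of them takes
it and `a` chooses; if they dislike it, `a` takes it and another agent chooses. -/
theorem not_two_split {a b : ι} (ha : a ∈ A) (hb : b ∈ A) (hab : a ≠ b) (j : Fin 3)
    {X Y : Finset ℕ} (hX : X ⊆ G \ P a j) (hY : Y ⊆ G \ P a j) (hXY : Disjoint X Y)
    (hbX : I.Likes b X) (hbY : I.Likes b Y) : False := by
  have hY' : I.Likes b ((G \ P a j) \ X) := hbY.mono fun y hy =>
    Finset.mem_sdiff.2 ⟨hY hy, Finset.disjoint_right.1 hXY hy⟩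
  have hsub := (h.division a ha).sub j
  have main : ∀ c ∈ A, ∀ d ∈ A, c ≠ d → c ≠ b → d ≠ b → I.Likes c (P a j) →
      2 * I.mu d ≤ I.val d (G \ P a j) → False := by
    intro c hc d hd hcd hcb hdb hlc hd2
    have d1 : Disjoint (P a j) X := Finset.disjoint_of_subset_right hX Finset.disjoint_sdiff
    have d2 : Disjoint (P a j) ((G \ P a j) \ X) :=
      Finset.disjoint_of_subset_right Finset.sdiff_subset Finset.disjoint_sdiff
    have s1 : X ⊆ G := hX.trans Finset.sdiff_subset
    have s2 : (G \ P a j) \ X ⊆ G := Finset.sdiff_subset.trans Finset.sdiff_subset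
    rcases likes_or_likes_sdiff hX hd2 with hh | hh
    · exact h.false_of_three hc hb hd hcb hcd hdb.symm hsub s2 s1 d2 d1
        Finset.disjoint_sdiff.symm hlc hY' hh
    · exact h.false_of_three hc hb hd hcb hcd hdb.symm hsub s1 s2 d1 d2
        Finset.disjoint_sdiff hlc hbX hh
  obtain ⟨c, hc, hca, hcb⟩ := h.exists_third a b
  by_cases hj : j = l a
  · refine main c hc a ha hca hcb hab ((h.likes_iff a ha c hc hca j).2 hj) ?_
    obtain ⟨j₁, j₂, h1, h2, h12, -⟩ := j.exists_others
    have hd := h.division a ha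
    have : P a j₁ ∪ P a j₂ ⊆ G \ P a j := Finset.union_subset
      (fun x hx => Finset.mem_sdiff.2 ⟨hd.sub _ hx, Finset.disjoint_left.1 (hd.disj _ _ h1) hx⟩)
      (fun x hx => Finset.mem_sdiff.2 ⟨hd.sub _ hx, Finset.disjoint_left.1 (hd.disj _ _ h2) hx⟩)
    have h3 := val_mono (I := I) (a := a) this
    rw [val_union (hd.disj _ _ h12)] at h3
    have h4 := hd.likes j₁
    have h5 := hd.likes j₂
    simp only [Likes] at h4 h5
    linarith
  · refine main a ha c hc hca.symm hab hcb ((h.division a ha).likes j) ?_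
    have h1 := (h.likes_iff a ha c hc hca j).not.2 hj
    have h2 := (h.division c hc).three_mul_le
    rw [val_sdiff hsub]
    simp only [Likes] at h1
    linarith

/-- A bundle disliked by the others meets all bundles of the others. -/
theorem inter_nonempty {a b : ι} (ha : a ∈ A) (hb : b ∈ A) (hab : a ≠ b) {j : Fin 3}
    (hj : j ≠ l a) (i : Fin 3) : (P a j ∩ P b i).Nonempty := by
  rw [← Finset.not_disjoint_iff_nonempty_inter]
  intro hdis
  have hd := h.division b hb
  have hsub := (h.division a ha).sub j
  have hX : P b i ⊆ G \ P a j := fun x hx =>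
    Finset.mem_sdiff.2 ⟨hd.sub i hx, Finset.disjoint_right.1 hdis hx⟩
  refine h.not_two_split ha hb hab j hX Finset.sdiff_subset Finset.disjoint_sdiff (hd.likes i) ?_
  -- The goods outside `P b i` are worth two thresholds to `b`, and removing the disliked `P a j`
  -- costs less than one.
  have h1 := (h.likes_iff a ha b hb hab.symm j).not.2 hj
  obtain ⟨j₁, j₂, n1, n2, n12, hall⟩ := i.exists_others
  have h2 : I.val b (P b i) + I.val b (P b j₁) + I.val b (P b j₂) ≤ I.val b G := by
    rw [← val_union (hd.disj _ _ n1.symm), ← val_union]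
    · exact val_mono (Finset.union_subset (Finset.union_subset (hd.sub _) (hd.sub _)) (hd.sub _))
    · exact Finset.disjoint_union_left.2 ⟨hd.disj _ _ n2.symm, hd.disj _ _ n12⟩
  have h3 := hd.likes j₁
  have h4 := hd.likes j₂
  simp only [Likes] at h1 h3 h4 ⊢
  rw [val_sdiff hX, val_sdiff hsub]
  linarith

/-- Otherwise exchanges would free `P a j` at the cost of `P b i` alone, leaving `b` two liked
bundles outside `P a j`, against `not_two_split`. -/
theorem not_dominates {a b : ι} (ha : a ∈ A) (hb : b ∈ A) (hab : a ≠ b) (i j : Fin 3) :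
    ¬ Dominates (P b i) (P a j) := by
  intro hdom
  have hd := h.division b hb
  obtain ⟨j₁, j₂, n1, n2, n12, -⟩ := i.exists_others
  let Q : ℕ → Finset ℕ := fun k => if k = 0 then P b j₁ else P b j₂
  have hQ : I.IsPacking b G {0, 1} Q := by
    refine ⟨?_, ?_, ?_⟩ <;> simp [Q, hd.sub, hd.likes, hd.disj _ _ n12, hd.disj _ _ n12.symm]
  obtain ⟨Q', hQ', -⟩ := hQ.remove_of_dominates (hd.sub i)
    (by simp [Q, hd.disj _ _ n1.symm, hd.disj _ _ n2.symm]) ((h.division a ha).sub j) hdom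
  exact h.not_two_split ha hb hab j (hQ'.sub 0 (by simp)) (hQ'.sub 1 (by simp))
    (hQ'.disj 0 (by simp) 1 (by simp) (by simp)) (hQ'.likes 0 (by simp)) (hQ'.likes 1 (by simp))

theorem three_le_card {a : ι} (ha : a ∈ A) {j : Fin 3} (hj : j ≠ l a) : 3 ≤ (P a j).card := by
  obtain ⟨b, hb, hba, -⟩ := h.exists_third a a
  rw [(h.division b hb).card_eq_inter ((h.division a ha).sub j), Fin.sum_univ_three]
  have := (h.inter_nonempty ha hb hba.symm hj 0).card_pos
  have := (h.inter_nonempty ha hb hba.symm hj 1).card_pos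
  have := (h.inter_nonempty ha hb hba.symm hj 2).card_pos
  omega

/-- At most one agent has a bundle with at most two goods. -/
theorem eq_of_card_le_two {b c : ι} (hb : b ∈ A) (hc : c ∈ A) {i j : Fin 3}
    (hi : (P b i).card ≤ 2) (hj : (P c j).card ≤ 2) : b = c := by
  by_contra hbc
  have hi' : i = l b := by
    by_contra hne
    have := h.three_le_card hb hne
    omega
  have hj' : j = l c := by
    by_contra hne
    have := h.three_le_card hc hne
    omega
  -- The two disliked bundles of `a` each take a good of `P b i`, so at most two goods leave nothing
  -- for `P a (l a)`.
  have aux : ∀ a ∈ A, ∀ b ∈ A, a ≠ b → ∀ i, (P b i).card ≤ 2 → Disjoint (P a (l a)) (P b i) := by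
    intro a ha b hb hab i hi
    obtain ⟨j₁, j₂, n1, n2, n12, hall⟩ := (l a).exists_others
    have h1 := (h.inter_nonempty ha hb hab n1 i).card_pos
    have h2 := (h.inter_nonempty ha hb hab n2 i).card_pos
    have hd := h.division a ha
    have hE := hd.card_eq_inter ((h.division b hb).sub i)
    rw [Finset.disjoint_iff_inter_eq_empty, ← Finset.card_eq_zero]
    have hsum : ∑ k, (P b i ∩ P a k).card = (P b i ∩ P a (l a)).card + (P b i ∩ P a j₁).card +
        (P b i ∩ P a j₂).card := by
      have : (Finset.univ : Finset (Fin 3)) = {l a, j₁, j₂} := by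
        ext k; simpa using hall k
      rw [this, Finset.sum_insert (by simp [n1.symm, n2.symm]), Finset.sum_pair n12, add_assoc]
    rw [hsum] at hE
    simp only [Finset.inter_comm (P b i)] at hE
    omega
  obtain ⟨a, ha, hab, hac⟩ := h.exists_third b c
  subst hi' hj'
  -- The three bundles picked by `l` are disjoint: `a` and `b` trade theirs, and `c` keeps her own.
  exact h.false_of_three ha hb hc hab hac hbc ((h.division b hb).sub _)
    ((h.division a ha).sub (l a)) ((h.division c hc).sub _) (aux a ha b hb hab _ hi).symm
    (aux b hb c hc hbc _ hj) (aux a ha c hc hac _ hj)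
    ((h.likes_iff b hb a ha hab _).2 rfl) ((h.likes_iff a ha b hb hab.symm _).2 rfl)
    ((h.division c hc).likes _)

end IsStuck

/-- An agent with two bundles of at most two goods makes the instance solvable. -/
theorem exists_solvable_of_two_pairs {A : Finset ι} {G : Finset ℕ}
    (hA : A.card = 3) (hP : ∀ a ∈ A, ∃ P, I.IsDivision a G P) {x : ι} (hx : x ∈ A)
    {P₀ : Fin 3 → Finset ℕ} (hP₀ : I.IsDivision x G P₀) {i j : Fin 3} (hij : i ≠ j)
    (hi : (P₀ i).card ≤ 2) (hj : (P₀ j).card ≤ 2) : I.Solvable A G := by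
  classical
  have : ∀ a, ∃ P, a ∈ A → I.IsDivision a G P ∧ (a = x → P = P₀) := by
    intro a
    by_cases hax : a = x
    · exact ⟨P₀, fun _ => ⟨hax ▸ hP₀, fun _ => rfl⟩⟩
    · by_cases ha : a ∈ A
      · obtain ⟨P, hP⟩ := hP a ha
        exact ⟨P, fun _ => ⟨hP, fun h => absurd h hax⟩⟩
      · exact ⟨P₀, fun h => absurd h ha⟩
  choose P hP' using this
  by_contra hcon
  obtain ⟨l, hl⟩ := exists_isStuck hA.ge (fun a ha => (hP' a ha).1) fun X hX hX3 hs =>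
    hcon (Finset.eq_of_subset_of_card_le hX (hA.trans hX3.symm).le ▸ hs)
  have hx' : P x = P₀ := (hP' x hx).2 rfl
  by_cases h : i = l x
  · have := hl.three_le_card hx (j := j) fun e => hij (h.trans e.symm)
    rw [hx'] at this
    omega
  · have := hl.three_le_card hx h
    rw [hx'] at this
    omega

end OrderedInstance

/-! ### Nine goods. -/

theorem Finset.exists_eq_triple_of_card_eq_three {S : Finset ℕ} (h : S.card = 3) :
    ∃ x y z, x < y ∧ y < z ∧ S = {x, y, z} := by
  obtain ⟨x, y, z, hxy, hxz, hyz, rfl⟩ := Finset.card_eq_three.1 h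
  rcases lt_or_gt_of_ne hxy with h1 | h1 <;> rcases lt_or_gt_of_ne hxz with h2 | h2 <;>
    rcases lt_or_gt_of_ne hyz with h3 | h3
  · exact ⟨x, y, z, h1, h3, rfl⟩
  · exact ⟨x, z, y, h2, h3, by grind⟩
  · omega
  · exact ⟨z, x, y, h2, h1, by grind⟩
  · exact ⟨y, x, z, h1, h2, by grind⟩
  · omega
  · exact ⟨y, z, x, h3, h2, by grind⟩
  · exact ⟨z, y, x, h3, h1, by grind⟩

theorem Finset.exists_eq_triple_of_min {S : Finset ℕ} (h : S.card = 3) {m : ℕ} (hm : m ∈ S)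
    (hmin : ∀ x ∈ S, m ≤ x) : ∃ u v, m < u ∧ u < v ∧ S = {m, u, v} := by
  obtain ⟨x, y, z, hxy, hyz, rfl⟩ := exists_eq_triple_of_card_eq_three h
  have := hmin x (by simp)
  have : m = x := by
    simp only [mem_insert, mem_singleton] at hm
    omega
  subst this
  exact ⟨y, z, hxy, hyz, rfl⟩

namespace OrderedInstance

variable {ι : Type*} {I : OrderedInstance ι}

namespace IsStuck

variable {A : Finset ι} {G : Finset ℕ} {P : ι → Fin 3 → Finset ℕ} {l : ι → Fin 3}
  (h : I.IsStuck A G P l)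
include h

theorem card_inter_of_card_eq_three {a b : ι} (ha : a ∈ A) (hb : b ∈ A) (hab : a ≠ b) {j : Fin 3}
    (hj : j ≠ l a) (h3 : (P a j).card = 3) (i : Fin 3) : (P a j ∩ P b i).card = 1 := by
  have hE := (h.division b hb).card_eq_inter ((h.division a ha).sub j)
  rw [Fin.sum_univ_three] at hE
  have h0 := (h.inter_nonempty ha hb hab hj 0).card_pos
  have h1 := (h.inter_nonempty ha hb hab hj 1).card_pos
  have h2 := (h.inter_nonempty ha hb hab hj 2).card_pos
  fin_cases i <;> simp only [Fin.zero_eta, Fin.mk_one, Fin.reduceFinMk] <;> omega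

/-- A disliked triple meets all three bundles of `b`, hence each in one good. The bundle picked by
`l a` is handled by counting inside `P b i`, where the other two bundles of `a` use up one good
each. -/
theorem card_inter_eq_one {a b : ι} (ha : a ∈ A) (hb : b ∈ A) (hab : a ≠ b)
    (ha3 : ∀ j, (P a j).card = 3) (hb3 : ∀ j, (P b j).card = 3) (i j : Fin 3) :
    (P a j ∩ P b i).card = 1 := by
  by_cases hj : j = l a
  · obtain ⟨j₁, j₂, n1, n2, n12, hall⟩ := j.exists_others
    have h1 := h.card_inter_of_card_eq_three ha hb hab (hj ▸ n1) (ha3 _) i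
    have h2 := h.card_inter_of_card_eq_three ha hb hab (hj ▸ n2) (ha3 _) i
    have hE := (h.division a ha).card_eq_inter ((h.division b hb).sub i)
    have : (Finset.univ : Finset (Fin 3)) = {j, j₁, j₂} := by
      ext k; simpa using hall k
    rw [this, Finset.sum_insert (by simp [n1.symm, n2.symm]), Finset.sum_pair n12, hb3] at hE
    simp only [Finset.inter_comm (P b i)] at hE
    omega
  · exact h.card_inter_of_card_eq_three ha hb hab hj (ha3 j) i

/-- The pairs completing the best good to a bundle of three are strictly nested. -/
theorem nested_of_triples {a b : ι} (ha : a ∈ A) (hb : b ∈ A) (hab : a ≠ b) {i j : Fin 3}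
    {m u v u' v' : ℕ} (hmu : m < u) (huv : u < v) (hmu' : m < u') (huv' : u' < v')
    (hC : P a i = {m, u, v}) (hC' : P b j = {m, u', v'}) :
    (u < u' ∧ v' < v) ∨ (u' < u ∧ v < v') := by
  have h1 := h.not_dominates ha hb hab j i
  have h2 := h.not_dominates hb ha hab.symm i j
  rw [hC, hC'] at h1 h2
  have h3 : ¬ (u' ≤ u ∧ v' ≤ v) := fun hh => h1 <| Dominates.of_triple (by simp) (by simp) (by simp)
    (by omega) (by omega) (by omega) le_rfl hh.1 hh.2 (by omega) (by omega) (by omega)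
  have h4 : ¬ (u ≤ u' ∧ v ≤ v') := fun hh => h2 <| Dominates.of_triple (by simp) (by simp) (by simp)
    (by omega) (by omega) (by omega) le_rfl hh.1 hh.2 (by omega) (by omega) (by omega)
  omega

/-- The bundles containing the best good `m` are triples `{m, u, v}` whose pairs are strictly
nested, so the worst goods `v` of two agents differ. A third agent's bundle through the larger one
of these goods is incompatible with the agent whose `v` is smaller. -/
theorem false_of_card_eq_nine (hG : G.card = 9) {a b c : ι} (ha : a ∈ A) (hb : b ∈ A) (hc : c ∈ A)
    (hab : a ≠ b) (hac : a ≠ c) (hbc : b ≠ c) (ha3 : ∀ j, (P a j).card = 3)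
    (hb3 : ∀ j, (P b j).card = 3) (hc3 : ∀ j, (P c j).card = 3) : False := by
  have hne : G.Nonempty := Finset.card_pos.1 (by omega)
  obtain ⟨m, hmG, hmin⟩ : ∃ m ∈ G, ∀ x ∈ G, m ≤ x :=
    ⟨G.min' hne, G.min'_mem hne, fun x hx => G.min'_le x hx⟩
  have rep : ∀ x ∈ A, (∀ j, (P x j).card = 3) → ∃ i u v, m < u ∧ u < v ∧ P x i = {m, u, v} := by
    intro x hx hx3
    obtain ⟨i, hi⟩ := (h.division x hx).exists_mem hmG
    obtain ⟨u, v, h1, h2, h3⟩ := Finset.exists_eq_triple_of_min (hx3 i) hi fun y hy =>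
      hmin y ((h.division x hx).sub i hy)
    exact ⟨i, u, v, h1, h2, h3⟩
  have key : ∀ a ∈ A, ∀ b ∈ A, ∀ c ∈ A, a ≠ b → b ≠ c → (∀ j, (P a j).card = 3) →
      (∀ j, (P b j).card = 3) → (∀ j, (P c j).card = 3) → ∀ i i' i'' u v u' v' u'' v'',
      m < u → u < v → m < u' → u' < v' → m < u'' → u'' < v'' → P a i = {m, u, v} →
      P b i' = {m, u', v'} → P c i'' = {m, u'', v''} → v < v'' → False := by
    intro a ha b hb c hc hab hbc ha3 hb3 hc3 i i' i'' u v u' v' u'' v'' p1 p2 p3 p4 p5 p6 e1 e2 e3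
      hvv
    have hbd := h.division b hb
    obtain ⟨k, hk⟩ := hbd.exists_mem ((h.division c hc).sub i'' (by rw [e3]; simp : v'' ∈ P c i''))
    have hmk : m ∉ P b k := by
      intro hm
      have h1 := h.card_inter_eq_one hb hc hbc hb3 hc3 i'' k
      have h2 : ({m, v''} : Finset ℕ) ⊆ P b k ∩ P c i'' := by
        intro x hx
        simp only [Finset.mem_insert, Finset.mem_singleton] at hx
        rcases hx with rfl | rfl
        · exact Finset.mem_inter.2 ⟨hm, by rw [e3]; simp⟩
        · exact Finset.mem_inter.2 ⟨hk, by rw [e3]; simp⟩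
      have := Finset.card_le_card h2
      rw [Finset.card_pair (by omega)] at this
      omega
    -- This bundle avoids `m` and contains `v'' > v`. As `{m, u, v}` does not dominate it, `y < u`.
    -- So `x` and `y` lie strictly between `m` and `u`, `z` lies beyond `v`, and the bundle misses
    -- `{m, u, v}`, although the two must share a good.
    obtain ⟨x, y, z, hxy, hyz, hY⟩ := Finset.exists_eq_triple_of_card_eq_three (hb3 k)
    have hmx : m < x := lt_of_le_of_ne (hmin x (hbd.sub k (by rw [hY]; simp)))
      fun e => hmk (by rw [hY, e]; simp)
    have h1 := h.not_dominates hb ha hab.symm i k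
    rw [e1, hY] at h1
    have h2 : ¬ (u ≤ y ∧ v ≤ z) := fun hh => h1 <| Dominates.of_triple (by simp) (by simp) (by simp)
      (by omega) (by omega) (by omega) hmx.le hh.1 hh.2 (by omega) (by omega) (by omega)
    have h3 : v'' = x ∨ v'' = y ∨ v'' = z := by rw [hY] at hk; simpa using hk
    have h4 := h.card_inter_eq_one ha hb hab ha3 hb3 k i
    obtain ⟨g, hg⟩ := Finset.card_pos.1 (by omega : 0 < (P a i ∩ P b k).card)
    rw [e1, hY] at hg
    simp only [Finset.mem_inter, Finset.mem_insert, Finset.mem_singleton] at hg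
    omega
  obtain ⟨i, u, v, p1, p2, e1⟩ := rep a ha ha3
  obtain ⟨i', u', v', p3, p4, e2⟩ := rep b hb hb3
  obtain ⟨i'', u'', v'', p5, p6, e3⟩ := rep c hc hc3
  rcases lt_trichotomy v v'' with hv | hv | hv
  · exact key a ha b hb c hc hab hbc ha3 hb3 hc3 _ _ _ _ _ _ _ _ _ p1 p2 p3 p4 p5 p6 e1 e2 e3 hv
  · have := h.nested_of_triples ha hc hac p1 p2 p5 p6 e1 e3
    omega
  · exact key c hc b hb a ha hbc.symm hab.symm hc3 hb3 ha3 _ _ _ _ _ _ _ _ _ p5 p6 p3 p4 p1 p2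
      e3 e2 e1 hv

end IsStuck

/-- Three agents with divisions of nine goods into triples can be satisfied. -/
theorem solvable_of_triples {A : Finset ι} {G : Finset ℕ} (hA : A.card = 3) (hG : G.card = 9)
    (hP : ∀ a ∈ A, ∃ P, I.IsDivision a G P ∧ ∀ j, (P j).card = 3) : I.Solvable A G := by
  classical
  have : ∀ a, ∃ P, a ∈ A → I.IsDivision a G P ∧ ∀ j, (P j).card = 3 := fun a => by
    by_cases ha : a ∈ A
    · obtain ⟨P, hP⟩ := hP a ha
      exact ⟨P, fun _ => hP⟩
    · exact ⟨fun _ => ∅, fun h => absurd h ha⟩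
  choose P hP' using this
  by_contra hcon
  obtain ⟨l, hl⟩ := exists_isStuck hA.ge (fun a ha => (hP' a ha).1) fun X hX hX3 hs =>
    hcon (Finset.eq_of_subset_of_card_le hX (hA.trans hX3.symm).le ▸ hs)
  obtain ⟨a, b, c, hab, hac, hbc, rfl⟩ := Finset.card_eq_three.1 hA
  exact hl.false_of_card_eq_nine hG (a := a) (b := b) (c := c) (by simp) (by simp) (by simp)
    hab hac hbc (hP' a (by simp)).2 (hP' b (by simp)).2 (hP' c (by simp)).2

/-- Among four agents with divisions of nine goods into three, three can be satisfied. -/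
theorem exists_solvable_of_card_eq_nine {A : Finset ι} {G : Finset ℕ} (hA : 4 ≤ A.card)
    (hG : G.card = 9) (hP : ∀ a ∈ A, ∃ P, I.IsDivision a G P) :
    ∃ X ⊆ A, X.card = 3 ∧ I.Solvable X G := by
  classical
  have : ∀ a, ∃ P, a ∈ A → I.IsDivision a G P := fun a => by
    by_cases ha : a ∈ A
    · obtain ⟨P, hP⟩ := hP a ha
      exact ⟨P, fun _ => hP⟩
    · exact ⟨fun _ => ∅, fun h => absurd h ha⟩
  choose P hP' using this
  by_contra! hcon
  obtain ⟨l, hl⟩ := exists_isStuck (by omega) hP' hcon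
  let B := A.filter fun a => ∃ j, (P a j).card ≤ 2
  have hB : B.card ≤ 1 := Finset.card_le_one.2 fun b hb c hc => by
    obtain ⟨hb, i, hi⟩ := Finset.mem_filter.1 hb
    obtain ⟨hc, j, hj⟩ := Finset.mem_filter.1 hc
    exact hl.eq_of_card_le_two hb hc hi hj
  have hd : 2 < (A \ B).card := by
    have := Finset.le_card_sdiff B A
    omega
  obtain ⟨a, b, c, ha, hb, hc, hab, hac, hbc⟩ := Finset.two_lt_card_iff.1 hd
  -- Outside `B` all bundles have at least three goods, and nine goods leave no slack.
  have all3 : ∀ a ∈ A \ B, ∀ j, (P a j).card = 3 := by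
    intro a ha
    obtain ⟨haA, haB⟩ := Finset.mem_sdiff.1 ha
    have h3 : ∀ j, 3 ≤ (P a j).card := fun j => by
      by_contra hlt
      exact haB (Finset.mem_filter.2 ⟨haA, j, by omega⟩)
    have hE := (hP' a haA).card_eq
    rw [Fin.sum_univ_three] at hE
    have h0 := h3 0
    have h1 := h3 1
    have h2 := h3 2
    intro j
    fin_cases j <;> simp only [Fin.zero_eta, Fin.mk_one, Fin.reduceFinMk] <;> omega
  exact hl.false_of_card_eq_nine hG (Finset.sdiff_subset ha) (Finset.sdiff_subset hb)
    (Finset.sdiff_subset hc) hab hac hbc (all3 a ha) (all3 b hb) (all3 c hc)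

end OrderedInstance

/-! ### Ten goods. -/

theorem Finset.eq_triple_of_mem {S : Finset ℕ} (h : S.card = 3) {x y z : ℕ} (hx : x ∈ S)
    (hy : y ∈ S) (hz : z ∈ S) (hxy : x ≠ y) (hxz : x ≠ z) (hyz : y ≠ z) : S = {x, y, z} := by
  symm
  apply eq_of_subset_of_card_le
  · intro g hg
    simp only [mem_insert, mem_singleton] at hg
    rcases hg with rfl | rfl | rfl <;> assumption
  · rw [h, card_eq_three.2 ⟨x, y, z, hxy, hxz, hyz, rfl⟩]

/-- Exchanging the goods of two nested pairs makes a bundle better or worse for everybody. -/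
theorem dominates_of_nested {T T' : Finset ℕ} {u v u' v' w : ℕ} (hu : u < u') (hu' : u' < v')
    (hv : v' < v) (h3 : T'.card = 3) (huT : u ∈ T) (hvT : v ∈ T')
    (h : u' ∈ T ∧ v' ∈ T' ∨ v' ∈ T ∧ u' ∈ T') (hw : w ∈ T) (hw' : w ∈ T') (n1 : w ≠ u)
    (n2 : w ≠ v) (n3 : w ≠ u') (n4 : w ≠ v') : Dominates T T' := by
  rcases h with ⟨h1, h2⟩ | ⟨h1, h2⟩
  · rw [Finset.eq_triple_of_mem h3 hvT h2 hw' (by omega) n2.symm n4.symm]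
    exact Dominates.of_triple huT h1 hw (by omega) n1.symm n3.symm (by omega) (by omega) le_rfl
      (by omega) n2.symm n4.symm
  · rw [Finset.eq_triple_of_mem h3 h2 hvT hw' (by omega) n3.symm n2.symm]
    exact Dominates.of_triple huT h1 hw (by omega) n1.symm n4.symm (by omega) (by omega) le_rfl
      (by omega) n3.symm n2.symm

theorem Finset.mem_xor_of_card_inter {T C : Finset ℕ} {m u v : ℕ} (h : (T ∩ C).card = 1)
    (hC : C = {m, u, v}) (hm : m ∉ T) (huv : u ≠ v) : u ∈ T ∧ v ∉ T ∨ u ∉ T ∧ v ∈ T := by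
  subst hC
  obtain ⟨w, hw⟩ := card_eq_one.1 h
  have hx : ∀ x, (x ∈ T ∧ (x = m ∨ x = u ∨ x = v)) ↔ x = w := fun x => by
    have := congrArg (x ∈ ·) hw
    simpa using this
  have h1 := hx u
  have h2 := hx v
  have h3 := hx w
  grind

namespace OrderedInstance

variable {ι : Type*} {I : OrderedInstance ι}

namespace IsStuck

variable {A : Finset ι} {G : Finset ℕ} {P : ι → Fin 3 → Finset ℕ} {l : ι → Fin 3}
  (h : I.IsStuck A G P l)
include h

/-- Two disliked triples meet exactly one of two nested pairs in the same good. -/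
theorem iff_not_iff_of_triples {a a' b b' : ι} (ha : a ∈ A) (ha' : a' ∈ A) (hb : b ∈ A)
    (hb' : b' ∈ A) (haa : a ≠ a') (hbb : b ≠ b') (hab : a ≠ b) (hab' : a ≠ b') (hab2 : a' ≠ b)
    (hab2' : a' ≠ b') {k k' i i' : Fin 3} {m u v u' v' : ℕ}
    (hk : k ≠ l a) (hk3 : (P a k).card = 3) (hkm : m ∉ P a k)
    (hk' : k' ≠ l a') (hk3' : (P a' k').card = 3) (hkm' : m ∉ P a' k')
    (hmu : m < u) (huv : u < v) (hmu' : m < u') (huv' : u' < v')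
    (hC : P b i = {m, u, v}) (hC' : P b' i' = {m, u', v'}) :
    (u ∈ P a k ↔ u' ∈ P a k) ↔ ¬ (u ∈ P a' k' ↔ u' ∈ P a' k') := by
  have hN := h.nested_of_triples hb hb' hbb hmu huv hmu' huv' hC hC'
  have x1 := Finset.mem_xor_of_card_inter (h.card_inter_of_card_eq_three ha hb hab hk hk3 i)
    hC hkm huv.ne
  have x2 := Finset.mem_xor_of_card_inter (h.card_inter_of_card_eq_three ha hb' hab' hk hk3 i')
    hC' hkm huv'.ne
  have x3 := Finset.mem_xor_of_card_inter (h.card_inter_of_card_eq_three ha' hb hab2 hk' hk3' i)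
    hC hkm' huv.ne
  have x4 := Finset.mem_xor_of_card_inter (h.card_inter_of_card_eq_three ha' hb' hab2' hk' hk3' i')
    hC' hkm' huv'.ne
  obtain ⟨w, hw⟩ := Finset.card_eq_one.1 (h.card_inter_of_card_eq_three ha ha' haa hk hk3 k')
  have hww : ∀ x, x ∈ P a k ∧ x ∈ P a' k' ↔ x = w := fun x => by
    rw [← Finset.mem_inter, hw, Finset.mem_singleton]
  have d1 := h.not_dominates ha ha' haa k' k
  have d2 := h.not_dominates ha' ha haa.symm k k'
  have huu : u ≠ u' := by omega
  have hvv : v ≠ v' := by omega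
  have huv1 : u ≠ v' := by omega
  have huv2 : v ≠ u' := by omega
  obtain ⟨w1, w2⟩ := (hww w).2 rfl
  have n1 := hww u
  have n2 := hww v
  have n3 := hww u'
  have n4 := hww v'
  -- Each triple contains exactly one good of each pair. Agreement on both pairs gives two common
  -- goods, but there is only one, `w`. Disagreement on both puts `w` outside the pairs, and by
  -- nestedness one triple dominates the other.
  by_cases e1 : u ∈ P a k ↔ u ∈ P a' k'
  · by_cases e2 : u' ∈ P a k ↔ u' ∈ P a' k'
    · exfalso
      grind
    · grind
  · by_cases e2 : u' ∈ P a k ↔ u' ∈ P a' k'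
    · grind
    · exfalso
      have m1 : w ≠ u := by grind
      have m2 : w ≠ v := by grind
      have m3 : w ≠ u' := by grind
      have m4 : w ≠ v' := by grind
      rcases hN with ⟨q1, q2⟩ | ⟨q1, q2⟩
      · by_cases hu : u ∈ P a k
        · exact d2 (dominates_of_nested q1 huv' q2 hk3' hu (by grind) (by grind) w1 w2 m1 m2 m3 m4)
        · exact d1 (dominates_of_nested q1 huv' q2 hk3 (by grind) (by grind) (by grind) w2 w1
            m1 m2 m3 m4)
      · by_cases hu : u' ∈ P a k
        · exact d2 (dominates_of_nested q1 huv q2 hk3' hu (by grind) (by grind) w1 w2 m3 m4 m1 m2)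
        · exact d1 (dominates_of_nested q1 huv q2 hk3 (by grind) (by grind) (by grind) w2 w1
            m3 m4 m1 m2)

/-- Two bundles of four goods that contain a common good share at most one further good. -/
theorem card_inter_le_two {a b : ι} (ha : a ∈ A) (hb : b ∈ A) (hab : a ≠ b) {i j : Fin 3}
    (hi : (P a i).card = 4) (hj : (P b j).card = 4) : (P a i ∩ P b j).card ≤ 2 := by
  by_cases hl : i = l a
  · obtain ⟨j₁, j₂, n1, n2, n12, hall⟩ := i.exists_others
    have hE := (h.division a ha).card_eq_inter ((h.division b hb).sub j)
    have : (Finset.univ : Finset (Fin 3)) = {i, j₁, j₂} := by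
      ext k; simpa using hall k
    rw [this, Finset.sum_insert (by simp [n1.symm, n2.symm]), Finset.sum_pair n12, hj] at hE
    simp only [Finset.inter_comm (P b j)] at hE
    have h1 := (h.inter_nonempty ha hb hab (hl ▸ n1) j).card_pos
    have h2 := (h.inter_nonempty ha hb hab (hl ▸ n2) j).card_pos
    omega
  · obtain ⟨j₁, j₂, n1, n2, n12, hall⟩ := j.exists_others
    have hE := (h.division b hb).card_eq_inter ((h.division a ha).sub i)
    have : (Finset.univ : Finset (Fin 3)) = {j, j₁, j₂} := by
      ext k; simpa using hall k
    rw [this, Finset.sum_insert (by simp [n1.symm, n2.symm]), Finset.sum_pair n12, hi] at hE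
    have h1 := (h.inter_nonempty ha hb hab hl j₁).card_pos
    have h2 := (h.inter_nonempty ha hb hab hl j₂).card_pos
    omega

end IsStuck

end OrderedInstance

theorem Finset.exists_eq_of_min_of_card_eq_four {S : Finset ℕ} (h : S.card = 4) {m : ℕ}
    (hm : m ∈ S) (hmin : ∀ x ∈ S, m ≤ x) :
    ∃ p q r, m < p ∧ p < q ∧ q < r ∧ S = {m, p, q, r} := by
  obtain ⟨p, q, r, hpq, hqr, hS⟩ := exists_eq_triple_of_card_eq_three (S := S.erase m)
    (by rw [card_erase_of_mem hm, h])
  have hp : p ∈ S.erase m := by rw [hS]; simp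
  refine ⟨p, q, r, lt_of_le_of_ne (hmin p (mem_of_mem_erase hp)) (ne_of_mem_erase hp).symm,
    hpq, hqr, ?_⟩
  rw [← hS, insert_erase hm]

namespace OrderedInstance

variable {ι : Type*} {I : OrderedInstance ι}

namespace IsStuck

variable {A : Finset ι} {G : Finset ℕ} {P : ι → Fin 3 → Finset ℕ} {l : ι → Fin 3}
  (h : I.IsStuck A G P l)
include h

/-- Among the two triples of `a`, consider the one, `{x, y, z}`, that reaches further; every good
beyond `z` is then in the bundle of four. Failure of domination forces `y a < p b` for different
agents. With four agents this confines `y` to `y ≤ 8`, leaving three possible pairs `(x, y)`, so two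
agents share one and one of their triples dominates the other. -/
theorem card_le_three_of_four {F : Finset ι} (hG : G = Finset.Ico 5 15) (hFA : F ⊆ A)
    {c : ι → Fin 3} (hc : ∀ a ∈ F, 5 ∈ P a (c a)) (h4 : ∀ a ∈ F, (P a (c a)).card = 4)
    (h3 : ∀ a ∈ F, ∀ j, j ≠ c a → (P a j).card = 3) : F.card ≤ 3 := by
  classical
  have hmin : ∀ a ∈ F, ∀ j, ∀ x ∈ P a j, 5 ≤ x := fun a ha j x hx => by
    have := (h.division a (hFA ha)).sub j hx
    rw [hG, Finset.mem_Ico] at this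
    exact this.1
  have data : ∀ a, ∃ k x y z p q r, a ∈ F → 5 < x ∧ x < y ∧ y < z ∧ P a k = {x, y, z} ∧
      P a (c a) = {5, p, q, r} ∧ 5 < p ∧ p < q ∧ q < r ∧ ∀ g ∈ G, z < g → g ∈ P a (c a) := by
    intro a
    by_cases ha : a ∈ F
    swap
    · exact ⟨0, 0, 0, 0, 0, 0, 0, fun h => absurd h ha⟩
    obtain ⟨p, q, r, q1, q2, q3, hC⟩ := Finset.exists_eq_of_min_of_card_eq_four (h4 a ha) (hc a ha)
      (hmin a ha _)
    obtain ⟨j₁, j₂, n1, n2, n12, hall⟩ := (c a).exists_others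
    have hd := h.division a (hFA ha)
    obtain ⟨x₁, y₁, z₁, o1, o2, e1⟩ := Finset.exists_eq_triple_of_card_eq_three (h3 a ha j₁ n1)
    obtain ⟨x₂, y₂, z₂, o3, o4, e2⟩ := Finset.exists_eq_triple_of_card_eq_three (h3 a ha j₂ n2)
    have l1 : 5 < x₁ := lt_of_le_of_ne (hmin a ha j₁ x₁ (by rw [e1]; simp)) fun e =>
      n1 (hd.eq_of_mem (g := 5) (by rw [e1, e]; simp) (hc a ha))
    have l2 : 5 < x₂ := lt_of_le_of_ne (hmin a ha j₂ x₂ (by rw [e2]; simp)) fun e =>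
      n2 (hd.eq_of_mem (g := 5) (by rw [e2, e]; simp) (hc a ha))
    have key : ∀ g ∈ G, z₁ < g → z₂ < g → g ∈ P a (c a) := by
      intro g hg hg1 hg2
      obtain ⟨k, hk⟩ := hd.exists_mem hg
      rcases hall k with rfl | rfl | rfl
      · exact hk
      · rw [e1] at hk
        simp only [Finset.mem_insert, Finset.mem_singleton] at hk
        omega
      · rw [e2] at hk
        simp only [Finset.mem_insert, Finset.mem_singleton] at hk
        omega
    rcases le_total z₁ z₂ with hz | hz
    · exact ⟨j₂, x₂, y₂, z₂, p, q, r, fun _ => ⟨l2, o3, o4, e2, hC, q1, q2, q3,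
        fun g hg hzg => key g hg (by omega) hzg⟩⟩
    · exact ⟨j₁, x₁, y₁, z₁, p, q, r, fun _ => ⟨l1, o1, o2, e1, hC, q1, q2, q3,
        fun g hg hzg => key g hg hzg (by omega)⟩⟩
  choose k x y z p q r hdat using data
  have int2 : ∀ a ∈ F, ∀ b ∈ F, a ≠ b → (P a (c a) ∩ P b (c b)).card ≤ 2 := fun a ha b hb hab =>
    h.card_inter_le_two (hFA ha) (hFA hb) hab (h4 a ha) (h4 b hb)
  have hyp : ∀ a ∈ F, ∀ b ∈ F, a ≠ b → y a < p b := by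
    intro a ha b hb hab
    obtain ⟨a1, a2, a3, a4, a5, a6, a7, a8, a9⟩ := hdat a ha
    obtain ⟨b1, b2, b3, b4, b5, b6, b7, b8, b9⟩ := hdat b hb
    by_contra hlt
    have hnd := h.not_dominates (hFA ha) (hFA hb) hab (c b) (k a)
    rw [a4, b5] at hnd
    -- Since `p b ≤ y a`, the alternative `q b ≤ z a` would let `{5, p b, q b}` dominate the triple
    -- of `a`. Hence `q b` and `r b` lie beyond `z a` and, with `5`, are three goods common to the
    -- two bundles of four.
    have hq : z a < q b := by
      by_contra hq
      exact hnd (Dominates.of_triple (a := 5) (b := p b) (c := q b) (by simp) (by simp) (by simp)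
        (by omega) (by omega) (by omega) (by omega) (by omega) (by omega) (by omega) (by omega)
        (by omega))
    have hsub := (h.division b (hFA hb)).sub (c b)
    have s1 : ({5, q b, r b} : Finset ℕ) ⊆ P a (c a) ∩ P b (c b) := by
      intro g hg
      simp only [Finset.mem_insert, Finset.mem_singleton] at hg
      have hgb : g ∈ P b (c b) := by
        rw [b5]; simp only [Finset.mem_insert, Finset.mem_singleton]; tauto
      refine Finset.mem_inter.2 ⟨?_, hgb⟩
      rcases hg with rfl | hg
      · exact hc a ha
      · exact a9 g (hsub hgb) (by omega)
    have := Finset.card_le_card s1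
    rw [Finset.card_eq_three.2 ⟨5, q b, r b, by omega, by omega, by omega, rfl⟩] at this
    have := int2 a ha b hb hab
    omega
  by_contra hF
  have hle : ∀ a ∈ F, y a ≤ 8 := by
    intro a ha
    by_contra hy
    -- If `y a ≥ 9`, three other agents have `p ≥ 10`. Without `5`, their bundles are three triples
    -- in the five goods `Ico 10 15`, pairwise sharing at most one good; but such triples cover at
    -- least `9 - 3 = 6` goods.
    have he : 2 < (F.erase a).card := by rw [Finset.card_erase_of_mem ha]; omega
    obtain ⟨b₁, b₂, b₃, m1, m2, m3, n12, n13, n23⟩ := Finset.two_lt_card_iff.1 he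
    have sub : ∀ b ∈ F.erase a, (P b (c b)).erase 5 ⊆ Finset.Ico 10 15 ∧
        ((P b (c b)).erase 5).card = 3 := by
      intro b hb
      obtain ⟨hba, hb⟩ := Finset.mem_erase.1 hb
      have := hyp a ha b hb hba.symm
      obtain ⟨b1, b2, b3, b4, b5, b6, b7, b8, b9⟩ := hdat b hb
      refine ⟨fun g hg => ?_, by rw [Finset.card_erase_of_mem (hc b hb), h4 b hb]⟩
      obtain ⟨g1, g2⟩ := Finset.mem_erase.1 hg
      have g3 := (h.division b (hFA hb)).sub (c b) g2
      rw [hG, Finset.mem_Ico] at g3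
      rw [b5] at g2
      simp only [Finset.mem_insert, Finset.mem_singleton] at g2
      rw [Finset.mem_Ico]
      omega
    have int1 : ∀ b ∈ F.erase a, ∀ b' ∈ F.erase a, b ≠ b' →
        ((P b (c b)).erase 5 ∩ (P b' (c b')).erase 5).card ≤ 1 := by
      intro b hb b' hb' hbb
      have hb := Finset.mem_of_mem_erase hb
      have hb' := Finset.mem_of_mem_erase hb'
      have h1 : (P b (c b)).erase 5 ∩ (P b' (c b')).erase 5 = (P b (c b) ∩ P b' (c b')).erase 5 := by
        ext; simp; tauto
      rw [h1, Finset.card_erase_of_mem (Finset.mem_inter.2 ⟨hc b hb, hc b' hb'⟩)]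
      have := int2 b hb b' hb' hbb
      omega
    have i12 := int1 _ m1 _ m2 n12
    have i13 := int1 _ m1 _ m3 n13
    have i23 := int1 _ m2 _ m3 n23
    obtain ⟨s1, t1⟩ := sub _ m1
    obtain ⟨s2, t2⟩ := sub _ m2
    obtain ⟨s3, t3⟩ := sub _ m3
    generalize (P b₁ (c b₁)).erase 5 = X₁ at *
    generalize (P b₂ (c b₂)).erase 5 = X₂ at *
    generalize (P b₃ (c b₃)).erase 5 = X₃ at *
    have c1 := Finset.card_union_add_card_inter X₁ X₂
    have c2 := Finset.card_union_add_card_inter (X₁ ∪ X₂) X₃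
    have c3 : ((X₁ ∪ X₂) ∩ X₃).card ≤ (X₁ ∩ X₃).card + (X₂ ∩ X₃).card := by
      rw [Finset.union_inter_distrib_right]
      exact Finset.card_union_le _ _
    have c4 := Finset.card_le_card (Finset.union_subset (Finset.union_subset s1 s2) s3)
    simp only [Nat.card_Ico] at c4
    omega
  obtain ⟨a, ha, b, hb, hab, he⟩ := Finset.exists_ne_map_eq_of_card_lt_of_maps_to
    (s := F) (t := ({(6, 7), (6, 8), (7, 8)} : Finset (ℕ × ℕ))) (f := fun a => (x a, y a))
    (by simp; omega) (fun a ha => by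
      have := hle a ha
      obtain ⟨a1, a2, -⟩ := hdat a ha
      simp only [Finset.coe_insert, Finset.coe_singleton, Set.mem_insert_iff,
        Set.mem_singleton_iff, Prod.mk.injEq]
      omega)
  obtain ⟨hx, hy⟩ := Prod.mk.inj he
  have hz : ∀ a ∈ F, ∀ b ∈ F, a ≠ b → x a = x b → y a = y b → z a ≤ z b → False := by
    intro a ha b hb hab hx hy hz
    obtain ⟨a1, a2, a3, a4, -⟩ := hdat a ha
    obtain ⟨b1, b2, b3, b4, -⟩ := hdat b hb
    have hnd := h.not_dominates (hFA hb) (hFA ha) hab.symm (k a) (k b)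
    rw [a4, b4] at hnd
    exact hnd (Dominates.of_triple (a := x a) (b := y a) (c := z a) (by simp) (by simp) (by simp)
      (by omega) (by omega) (by omega) hx.le hy.le hz (by omega) (by omega) (by omega))
  rcases le_total (z a) (z b) with hh | hh
  · exact hz a ha b hb hab hx hy hh
  · exact hz b hb a ha hab.symm hx.symm hy.symm hh

/-- All bundle sizes are `3, 3, 4`. Let `F` be the agents whose bundle containing `5` has four goods
and `K` the others. Then `F` has at most three members, `K` at most four, and at most three if `F`
is nonempty. Five agents would therefore put at least two into each class and three into one, which
the parity relation `iff_not_iff_of_triples` excludes. -/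
theorem card_le_four_of_three_le {B : Finset ι} (hG : G = Finset.Ico 5 15) (hBA : B ⊆ A)
    (hB : ∀ a ∈ B, ∀ j, 3 ≤ (P a j).card) : B.card ≤ 4 := by
  classical
  have hc : ∀ a, ∃ c, a ∈ B → 5 ∈ P a c := fun a => by
    by_cases ha : a ∈ B
    · obtain ⟨c, hc⟩ := (h.division a (hBA ha)).exists_mem (g := 5) (by simp [hG])
      exact ⟨c, fun _ => hc⟩
    · exact ⟨0, fun h => absurd h ha⟩
  choose c hc using hc
  have hmin : ∀ a ∈ B, ∀ j, ∀ x ∈ P a j, 5 ≤ x ∧ x < 15 := fun a ha j x hx => by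
    have := (h.division a (hBA ha)).sub j hx
    rwa [hG, Finset.mem_Ico] at this
  have hcard : ∀ a ∈ B, ∀ i j k : Fin 3, i ≠ j → i ≠ k → j ≠ k →
      (P a i).card + (P a j).card + (P a k).card = 10 := by
    intro a ha i j k hij hik hjk
    have hE := (h.division a (hBA ha)).card_eq
    have : (Finset.univ : Finset (Fin 3)) = {i, j, k} := by
      revert i j k; decide
    rw [this, Finset.sum_insert (by simp [hij, hik]), Finset.sum_pair hjk, hG] at hE
    simp only [Nat.card_Ico] at hE
    omega
  let K := B.filter fun a => (P a (c a)).card = 3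
  let F := B.filter fun a => (P a (c a)).card ≠ 3
  have hKF : K.card + F.card = B.card := Finset.card_filter_add_card_filter_not _
  have hKB : K ⊆ B := Finset.filter_subset _ _
  have hFB : F ⊆ B := Finset.filter_subset _ _
  have hF4 : ∀ a ∈ F, (P a (c a)).card = 4 ∧ ∀ j, j ≠ c a → (P a j).card = 3 := by
    intro a ha
    obtain ⟨haB, h3⟩ := Finset.mem_filter.1 ha
    have h1 : ∀ j k, c a ≠ j → c a ≠ k → j ≠ k → (P a (c a)).card = 4 ∧ (P a j).card = 3 := by
      intro j k n1 n2 n3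
      have := hcard a haB (c a) j k n1 n2 n3
      have := hB a haB (c a)
      have := hB a haB j
      have := hB a haB k
      omega
    obtain ⟨j₁, j₂, n1, n2, n12, hall⟩ := (c a).exists_others
    refine ⟨(h1 j₁ j₂ n1.symm n2.symm n12).1, fun j hj => ?_⟩
    rcases hall j with rfl | rfl | rfl
    · exact absurd rfl hj
    · exact (h1 _ _ n1.symm n2.symm n12).2
    · exact (h1 _ _ n2.symm n1.symm n12.symm).2
  have hF3 : F.card ≤ 3 := h.card_le_three_of_four hG (hFB.trans hBA) (fun a ha => hc a (hFB ha))
    (fun a ha => (hF4 a ha).1) fun a ha => (hF4 a ha).2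
  have hrepK : ∀ b, ∃ u v, b ∈ K → 5 < u ∧ u < v ∧ P b (c b) = {5, u, v} := by
    intro b
    by_cases hb : b ∈ K
    · obtain ⟨hbB, h3⟩ := Finset.mem_filter.1 hb
      obtain ⟨u, v, h1⟩ := Finset.exists_eq_triple_of_min h3 (hc b hbB) fun x hx =>
        (hmin b hbB _ x hx).1
      exact ⟨u, v, fun _ => h1⟩
    · exact ⟨0, 0, fun h => absurd h hb⟩
  choose u v huv using hrepK
  have hdisF : ∀ a, ∃ k, a ∈ F → k ≠ l a ∧ (P a k).card = 3 ∧ 5 ∉ P a k := by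
    intro a
    by_cases ha : a ∈ F
    · obtain ⟨k, hk1, hk2⟩ : ∃ k : Fin 3, k ≠ l a ∧ k ≠ c a :=
        (by decide : ∀ i j : Fin 3, ∃ k, k ≠ i ∧ k ≠ j) _ _
      exact ⟨k, fun _ => ⟨hk1, (hF4 a ha).2 k hk2, fun h5 =>
        hk2 ((h.division a (hBA (hFB ha))).eq_of_mem h5 (hc a (hFB ha)))⟩⟩
    · exact ⟨0, fun h => absurd h ha⟩
  choose k hk using hdisF
  have hnest : ∀ b ∈ K, ∀ b' ∈ K, b ≠ b' →
      (u b < u b' ∧ v b' < v b) ∨ (u b' < u b ∧ v b < v b') := by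
    intro b hb b' hb' hbb
    obtain ⟨h1, h2, h3⟩ := huv b hb
    obtain ⟨h4, h5, h6⟩ := huv b' hb'
    exact h.nested_of_triples (hBA (hKB hb)) (hBA (hKB hb')) hbb h1 h2 h4 h5 h3 h6
  -- Strictly nested pairs are disjoint, and nine goods remain besides `5`.
  have hK4 : K.card ≤ 4 := by
    have hsub : (K.biUnion fun b => {u b, v b}) ⊆ Finset.Ico 6 15 := by
      intro g hg
      obtain ⟨b, hb, hg⟩ := Finset.mem_biUnion.1 hg
      obtain ⟨h1, h2, h3⟩ := huv b hb
      have h4 := hmin b (hKB hb) (c b) (v b) (by rw [h3]; simp)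
      simp only [Finset.mem_insert, Finset.mem_singleton] at hg
      rw [Finset.mem_Ico]
      omega
    have := Finset.card_le_card hsub
    rw [Finset.card_biUnion, Finset.sum_const_nat (m := 2)] at this
    · simp only [Nat.card_Ico] at this
      omega
    · intro b hb
      exact Finset.card_pair (huv b hb).2.1.ne
    · intro b hb b' hb' hbb
      have h1 := hnest b hb b' hb' hbb
      have h2 := huv b hb
      have h3 := huv b' hb'
      rw [Function.onFun, Finset.disjoint_left]
      intro g hg hg'
      simp only [Finset.mem_insert, Finset.mem_singleton] at hg hg'
      omega
  have hne : ∀ a ∈ F, ∀ b ∈ K, a ≠ b := fun a ha b hb e =>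
    (Finset.mem_filter.1 ha).2 (e ▸ (Finset.mem_filter.1 hb).2)
  have hK3 : ∀ a ∈ F, K.card ≤ 3 := by
    intro a ha
    obtain ⟨h1, h2, h3⟩ := hk a ha
    rw [← h2]
    have hx : ∀ b ∈ K, u b ∈ P a (k a) ∧ v b ∉ P a (k a) ∨ u b ∉ P a (k a) ∧ v b ∈ P a (k a) := by
      intro b hb
      exact Finset.mem_xor_of_card_inter (h.card_inter_of_card_eq_three (hBA (hFB ha))
        (hBA (hKB hb)) (hne a ha b hb) h1 h2 (c b)) (huv b hb).2.2 h3 (huv b hb).2.1.ne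
    -- A disliked triple of `a` without `5` contains one good from each of these disjoint pairs.
    refine Finset.card_le_card_of_injOn (fun b => if u b ∈ P a (k a) then u b else v b) ?_ ?_
    · intro b hb
      have := hx b hb
      dsimp only
      split_ifs with hu
      · exact hu
      · exact (this.resolve_left fun h => hu h.1).2
    · intro b hb b' hb' he
      by_contra hbb
      have h1 := hnest b hb b' hb' hbb
      have h2 := huv b hb
      have h3 := huv b' hb'
      dsimp only at he
      split_ifs at he <;> omega
  have hiff : ∀ a ∈ F, ∀ a' ∈ F, a ≠ a' → ∀ b ∈ K, ∀ b' ∈ K, b ≠ b' →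
      ((u b ∈ P a (k a) ↔ u b' ∈ P a (k a)) ↔ ¬ (u b ∈ P a' (k a') ↔ u b' ∈ P a' (k a'))) := by
    intro a ha a' ha' haa b hb b' hb' hbb
    obtain ⟨h1, h2, h3⟩ := huv b hb
    obtain ⟨h4, h5, h6⟩ := huv b' hb'
    obtain ⟨h7, h8, h9⟩ := hk a ha
    obtain ⟨g7, g8, g9⟩ := hk a' ha'
    exact h.iff_not_iff_of_triples (hBA (hFB ha)) (hBA (hFB ha')) (hBA (hKB hb)) (hBA (hKB hb'))
      haa hbb (hne _ ha _ hb) (hne _ ha _ hb') (hne _ ha' _ hb) (hne _ ha' _ hb') h7 h8 h9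
      g7 g8 g9 h1 h2 h4 h5 h3 h6
  by_contra hB5
  have hKle : K.card ≤ 3 := by
    rcases F.eq_empty_or_nonempty with hF | ⟨a, ha⟩
    · rw [hF, Finset.card_empty] at hKF
      omega
    · exact hK3 a ha
  obtain ⟨a, ha, a', ha', haa⟩ := Finset.one_lt_card.1 (by omega : 1 < F.card)
  obtain ⟨b, hb, b', hb', hbb⟩ := Finset.one_lt_card.1 (by omega : 1 < K.card)
  by_cases hK : K.card = 3
  -- For one agent of `F`, the number of pairs among `b₁, b₂, b₃` on which the membership of `u`
  -- differs is even. The relation would make these numbers for `a` and `a'` add up to three.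
  · obtain ⟨b₁, b₂, b₃, m1, m2, m3, n12, n13, n23⟩ := Finset.two_lt_card_iff.1 (by omega : 2 < K.card)
    have e1 := hiff a ha a' ha' haa b₁ m1 b₂ m2 n12
    have e2 := hiff a ha a' ha' haa b₁ m1 b₃ m3 n13
    have e3 := hiff a ha a' ha' haa b₂ m2 b₃ m3 n23
    clear * - e1 e2 e3
    grind
  -- Three truth values cannot be pairwise different.
  · obtain ⟨a₁, a₂, a₃, m1, m2, m3, n12, n13, n23⟩ := Finset.two_lt_card_iff.1 (by omega : 2 < F.card)
    have e1 := hiff a₁ m1 a₂ m2 n12 b hb b' hb' hbb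
    have e2 := hiff a₁ m1 a₃ m3 n13 b hb b' hb' hbb
    have e3 := hiff a₂ m2 a₃ m3 n23 b hb b' hb' hbb
    clear * - e1 e2 e3
    grind

end IsStuck

/-- Among six agents with divisions of ten goods into three, three can be satisfied. -/
theorem exists_solvable_of_card_eq_ten {A : Finset ι} (hA : 6 ≤ A.card)
    (hP : ∀ a ∈ A, ∃ P, I.IsDivision a (Finset.Ico 5 15) P) :
    ∃ X ⊆ A, X.card = 3 ∧ I.Solvable X (Finset.Ico 5 15) := by
  classical
  have : ∀ a, ∃ P, a ∈ A → I.IsDivision a (Finset.Ico 5 15) P := fun a => by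
    by_cases ha : a ∈ A
    · obtain ⟨P, hP⟩ := hP a ha
      exact ⟨P, fun _ => hP⟩
    · exact ⟨fun _ => ∅, fun h => absurd h ha⟩
  choose P hP' using this
  by_contra! hcon
  obtain ⟨l, hl⟩ := exists_isStuck (by omega) hP' hcon
  let B := A.filter fun a => ∃ j, (P a j).card ≤ 2
  have hB : B.card ≤ 1 := Finset.card_le_one.2 fun b hb c hc => by
    obtain ⟨hb, i, hi⟩ := Finset.mem_filter.1 hb
    obtain ⟨hc, j, hj⟩ := Finset.mem_filter.1 hc
    exact hl.eq_of_card_le_two hb hc hi hj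
  have := hl.card_le_four_of_three_le (B := A \ B) rfl Finset.sdiff_subset fun a ha j => by
    obtain ⟨haA, haB⟩ := Finset.mem_sdiff.1 ha
    by_contra hlt
    exact haB (Finset.mem_filter.2 ⟨haA, j, by omega⟩)
  have := Finset.le_card_sdiff B A
  omega

end OrderedInstance

/-! ### Giving away pairs; splits of total excess two. -/

theorem Dominates.of_pair {C : Finset ℕ} {a b x y : ℕ} (ha : a ∈ C) (hb : b ∈ C) (hab : a ≠ b)
    (hax : a ≤ x) (hby : b ≤ y) : Dominates C {x, y} := by
  refine ⟨fun s => if s = x then a else b, ?_, ?_⟩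
  · intro s hs t ht h
    simp only [Finset.coe_insert, Finset.coe_singleton, Set.mem_insert_iff,
      Set.mem_singleton_iff] at hs ht
    dsimp only at h
    grind
  · intro s hs
    simp only [Finset.mem_insert, Finset.mem_singleton] at hs
    grind

/-- `G` starts with the goods of `T`, followed by `p` and `q`. -/
structure IsStart (G T : Finset ℕ) (p q : ℕ) : Prop where
  sub : T ⊆ G
  hp : p ∈ G
  hq : q ∈ G
  lt : ∀ x ∈ T, x < p
  hpq : p < q
  le : ∀ x ∈ G, x ∉ T → x = p ∨ q ≤ x

theorem Finset.exists_initial (G : Finset ℕ) (k : ℕ) (hk : k ≤ G.card) :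
    ∃ T ⊆ G, T.card = k ∧ ∀ x ∈ T, ∀ y ∈ G \ T, x < y := by
  induction k with
  | zero => exact ⟨∅, by simp, by simp, by simp⟩
  | succ k ih =>
    obtain ⟨T, hT, hc, hlt⟩ := ih (by omega)
    have hne : (G \ T).Nonempty := by
      rw [← card_pos, card_sdiff_of_subset hT]
      omega
    have hm := (G \ T).min'_mem hne
    refine ⟨insert ((G \ T).min' hne) T, ?_, ?_, ?_⟩
    · exact insert_subset (mem_sdiff.1 hm).1 hT
    · rw [card_insert_of_notMem (mem_sdiff.1 hm).2, hc]
    · intro x hx y hy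
      simp only [mem_sdiff, mem_insert, not_or] at hy
      have hy' : y ∈ G \ T := mem_sdiff.2 ⟨hy.1, hy.2.2⟩
      rcases mem_insert.1 hx with rfl | hx
      · exact lt_of_le_of_ne ((G \ T).min'_le y hy') (Ne.symm hy.2.1)
      · exact hlt x hx y hy'

theorem exists_isStart {G : Finset ℕ} {k : ℕ} (hk : k + 2 ≤ G.card) :
    ∃ T p q, T.card = k ∧ IsStart G T p q := by
  obtain ⟨T, hT, hc, hlt⟩ := G.exists_initial k (by omega)
  have hne : (G \ T).Nonempty := by
    rw [← Finset.card_pos, Finset.card_sdiff_of_subset hT]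
    omega
  have hm := (G \ T).min'_mem hne
  set p := (G \ T).min' hne with hp
  have hne' : ((G \ T).erase p).Nonempty := by
    rw [← Finset.card_pos, Finset.card_erase_of_mem hm, Finset.card_sdiff_of_subset hT]
    omega
  have hq := ((G \ T).erase p).min'_mem hne'
  have hq' := Finset.mem_of_mem_erase hq
  refine ⟨T, p, ((G \ T).erase p).min' hne', hc, hT, Finset.sdiff_subset hm,
    Finset.sdiff_subset hq', fun x hx => hlt x hx p hm, ?_, ?_⟩
  · exact lt_of_le_of_ne ((G \ T).min'_le _ hq') (Finset.ne_of_mem_erase hq).symm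
  · intro x hx hxT
    by_cases hxp : x = p
    · exact Or.inl hxp
    · exact Or.inr (Finset.min'_le _ _ (Finset.mem_erase.2 ⟨hxp, Finset.mem_sdiff.2 ⟨hx, hxT⟩⟩))

namespace OrderedInstance

variable {ι : Type*} {I : OrderedInstance ι}

theorem IsPacking.mono {a : ι} {G H J J' : Finset ℕ} {P : ℕ → Finset ℕ} (h : I.IsPacking a G J P)
    (hG : G ⊆ H) (hJ : J' ⊆ J) : I.IsPacking a H J' P :=
  ⟨fun j hj => (h.sub j (hJ hj)).trans hG, fun i hi j hj => h.disj i (hJ hi) j (hJ hj),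
    fun j hj => h.likes j (hJ hj)⟩

/-- A set dominated by the bundle `i` together with all goods outside the bundles may be removed at
the cost of this bundle. -/
theorem IsPacking.remove_of_dominates_extended {a : ι} {G J : Finset ℕ} {P : ℕ → Finset ℕ}
    (h : I.IsPacking a G J P) {i : ℕ} {S : Finset ℕ} (hi : i ∈ J) (hS : S ⊆ G)
    (hd : Dominates (P i ∪ (G \ J.biUnion P)) S) :
    ∃ P', I.IsPacking a (G \ S) (J.erase i) P' ∧ ∀ j ∈ J.erase i, (P' j).card = (P j).card := by
  refine (h.mono subset_rfl (Finset.erase_subset i J)).remove_of_dominates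
    (Finset.union_subset (h.sub i hi) Finset.sdiff_subset) ?_ hS hd
  intro j hj
  obtain ⟨hji, hj⟩ := Finset.mem_erase.1 hj
  refine Finset.disjoint_union_left.2 ⟨h.disj i hi j hj hji.symm, ?_⟩
  rw [Finset.disjoint_left]
  intro x hx hxj
  exact (Finset.mem_sdiff.1 hx).2 (Finset.mem_biUnion.2 ⟨j, hj, hxj⟩)

theorem Split.mono {a : ι} {n E E' : ℕ} {G H : Finset ℕ} (h : I.Split a n E G) (hE : E ≤ E')
    (hG : G ⊆ H) : I.Split a n E' H := by
  obtain ⟨J, P, hP, hn, hs⟩ := h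
  exact ⟨J, P, hP.mono hG subset_rfl, hn, hs.trans hE⟩

theorem IsPacking.split_of_dominates {a : ι} {n E : ℕ} {G J : Finset ℕ} {P : ℕ → Finset ℕ}
    (h : I.IsPacking a G J P) (hn : J.card = n + 1) (hE : ∑ j ∈ J, ((P j).card - 2) ≤ E) {i : ℕ}
    {S : Finset ℕ} (hi : i ∈ J) (hS : S ⊆ G) (hd : Dominates (P i ∪ (G \ J.biUnion P)) S) :
    I.Split a n E (G \ S) := by
  obtain ⟨P', hP', hc⟩ := h.remove_of_dominates_extended hi hS hd
  refine ⟨_, P', hP', by rw [Finset.card_erase_of_mem hi, hn]; rfl, ?_⟩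
  rw [Finset.sum_congr rfl fun j hj => by rw [hc j hj]]
  exact (Finset.sum_le_sum_of_subset (Finset.erase_subset i J)).trans hE

/-- A disliked pair may be removed at the cost of one bundle. -/
theorem Split.sdiff_pair {a : ι} {n E : ℕ} {G : Finset ℕ} (h : I.Split a (n + 1) E G) {p q : ℕ}
    (hd : ¬ I.Likes a {p, q}) : I.Split a n E (G \ {p, q}) := by
  obtain ⟨J, P, hP, hn, hE⟩ := h
  have hJ : J.Nonempty := Finset.card_pos.1 (by omega)
  by_cases hone : ∃ i ∈ J, ∀ j ∈ J, j ≠ i → Disjoint (P j) {p, q}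
  · obtain ⟨i, hi, hdis⟩ := hone
    refine ⟨J.erase i, P, ?_, by rw [Finset.card_erase_of_mem hi, hn]; rfl,
      (Finset.sum_le_sum_of_subset (Finset.erase_subset i J)).trans hE⟩
    have := hP.mono subset_rfl (Finset.erase_subset i J)
    refine ⟨fun j hj => ?_, this.disj, this.likes⟩
    obtain ⟨hji, hj'⟩ := Finset.mem_erase.1 hj
    exact fun x hx => Finset.mem_sdiff.2 ⟨hP.sub j hj' hx, Finset.disjoint_left.1 (hdis j hj' hji) hx⟩
  push Not at hone
  have meets : ∀ i ∈ J, ∃ j ∈ J, j ≠ i ∧ (p ∈ P j ∨ q ∈ P j) := by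
    intro i hi
    obtain ⟨j, hj, hji, hnd⟩ := hone i hi
    refine ⟨j, hj, hji, ?_⟩
    rw [Finset.not_disjoint_iff] at hnd
    obtain ⟨x, hx, hx'⟩ := hnd
    simp only [Finset.mem_insert, Finset.mem_singleton] at hx'
    rcases hx' with rfl | rfl
    · exact Or.inl hx
    · exact Or.inr hx
  -- No single bundle can be dropped to free the pair, so `p` and `q` lie in different bundles.
  -- These are merged without `p` and `q`; the loss is below one threshold, and the total excess
  -- does not grow.
  obtain ⟨i, j, hi, hj, hij, hpi, hqj⟩ : ∃ i j, i ∈ J ∧ j ∈ J ∧ i ≠ j ∧ p ∈ P i ∧ q ∈ P j := by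
    obtain ⟨i₀, hi₀⟩ := hJ
    obtain ⟨i, hi, -, h1⟩ := meets i₀ hi₀
    obtain ⟨j, hj, hji, h2⟩ := meets i hi
    have huniq : ∀ x, x ∈ P i → x ∉ P j := fun x hx =>
      Finset.disjoint_left.1 (hP.disj i hi j hj hji.symm) hx
    rcases h1 with h1 | h1 <;> rcases h2 with h2 | h2
    · exact absurd h2 (huniq p h1)
    · exact ⟨i, j, hi, hj, hji.symm, h1, h2⟩
    · exact ⟨j, i, hj, hi, hji, h2, h1⟩
    · exact absurd h2 (huniq q h1)
  have hdij := hP.disj i hi j hj hij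
  have hsub : ({p, q} : Finset ℕ) ⊆ P i ∪ P j := by
    intro x hx
    simp only [Finset.mem_insert, Finset.mem_singleton] at hx
    rcases hx with rfl | rfl
    · exact Finset.mem_union_left _ hpi
    · exact Finset.mem_union_right _ hqj
  have hpq : p ≠ q := fun e => Finset.disjoint_left.1 hdij hpi (e ▸ hqj)
  have hiJ : i ∈ J.erase j := Finset.mem_erase.2 ⟨hij, hi⟩
  refine ⟨J.erase j, Function.update P i ((P i ∪ P j) \ {p, q}), ⟨?_, ?_, ?_⟩,
    by rw [Finset.card_erase_of_mem hj, hn]; rfl, ?_⟩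
  · intro k hk
    obtain ⟨hkj, hkJ⟩ := Finset.mem_erase.1 hk
    rcases eq_or_ne k i with rfl | hki
    · rw [Function.update_self]
      exact Finset.sdiff_subset_sdiff (Finset.union_subset (hP.sub k hkJ) (hP.sub j hj)) subset_rfl
    · rw [Function.update_of_ne hki]
      intro x hx
      refine Finset.mem_sdiff.2 ⟨hP.sub k hkJ hx, fun hx' => ?_⟩
      rcases Finset.mem_union.1 (hsub hx') with h1 | h1
      · exact Finset.disjoint_left.1 (hP.disj k hkJ i hi hki) hx h1
      · exact Finset.disjoint_left.1 (hP.disj k hkJ j hj hkj) hx h1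
  · have aux : ∀ k ∈ J.erase j, k ≠ i → Disjoint ((P i ∪ P j) \ {p, q}) (P k) := by
      intro k hk hki
      obtain ⟨hkj, hkJ⟩ := Finset.mem_erase.1 hk
      exact Finset.disjoint_of_subset_left Finset.sdiff_subset
        (Finset.disjoint_union_left.2 ⟨hP.disj i hi k hkJ hki.symm, hP.disj j hj k hkJ hkj.symm⟩)
    intro k hk k' hk' hkk
    rcases eq_or_ne k i with rfl | hki
    · rw [Function.update_self, Function.update_of_ne hkk.symm]
      exact aux k' hk' hkk.symm
    · rw [Function.update_of_ne hki]
      rcases eq_or_ne k' i with rfl | hki'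
      · rw [Function.update_self]
        exact (aux k hk hki).symm
      · rw [Function.update_of_ne hki']
        exact hP.disj k (Finset.mem_of_mem_erase hk) k' (Finset.mem_of_mem_erase hk') hkk
  · intro k hk
    rcases eq_or_ne k i with rfl | hki
    · rw [Function.update_self, Likes, val_sdiff hsub, val_union hdij]
      have h1 := hP.likes k hi
      have h2 := hP.likes j hj
      simp only [Likes] at h1 h2 hd
      linarith
    · rw [Function.update_of_ne hki]
      exact hP.likes k (Finset.mem_of_mem_erase hk)
  · rw [← Finset.add_sum_erase _ _ hiJ, Function.update_self]
    rw [← Finset.add_sum_erase _ _ hj, ← Finset.add_sum_erase _ _ hiJ] at hE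
    rw [Finset.sum_congr rfl fun k hk => by rw [Function.update_of_ne (Finset.ne_of_mem_erase hk)]]
    have hc : ((P i ∪ P j) \ {p, q}).card = (P i).card + (P j).card - 2 := by
      rw [Finset.card_sdiff_of_subset hsub, Finset.card_union_of_disjoint hdij,
        Finset.card_pair hpq]
    rw [hc]
    omega

/-- The `n + 1`st and the `n + 2`nd good may be removed at the cost of one bundle. -/
theorem Split.sdiff_start {a : ι} {n E : ℕ} {G T : Finset ℕ} {p q : ℕ}
    (h : I.Split a (n + 1) E G) (hT : IsStart G T p q) (hn : T.card = n) :
    I.Split a n E (G \ {p, q}) := by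
  obtain ⟨J, P, hP, hJ, hE⟩ := h
  obtain ⟨i₀, hi₀⟩ : J.Nonempty := Finset.card_pos.1 (by omega)
  have : ∀ g, ∃ i, i ∈ J ∧ (g ∈ G → g ∈ P i ∪ (G \ J.biUnion P)) := by
    intro g
    by_cases hg : g ∈ J.biUnion P
    · obtain ⟨i, hi, hgi⟩ := Finset.mem_biUnion.1 hg
      exact ⟨i, hi, fun _ => Finset.mem_union_left _ hgi⟩
    · exact ⟨i₀, hi₀, fun hgG => Finset.mem_union_right _ (Finset.mem_sdiff.2 ⟨hgG, hg⟩)⟩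
  choose f hf hfm using this
  have hpT : p ∉ insert q T := by
    rw [Finset.mem_insert, not_or]
    exact ⟨hT.hpq.ne, fun hp => lt_irrefl _ (hT.lt p hp)⟩
  have hqT : q ∉ T := fun hq => lt_asymm (hT.lt q hq) hT.hpq
  have hsubG : insert p (insert q T) ⊆ G :=
    Finset.insert_subset hT.hp (Finset.insert_subset hT.hq hT.sub)
  -- Pigeonhole: `n + 2` goods in `n + 1` bundles, unused goods being attached to an arbitrary
  -- bundle. Two goods `x < y` that fall together satisfy `x ≤ p` and `y ≤ q`, so they dominate the
  -- pair.
  obtain ⟨x, hx, y, hy, hxy, he⟩ := Finset.exists_ne_map_eq_of_card_lt_of_maps_to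
    (s := insert p (insert q T)) (t := J) (f := f)
    (by rw [Finset.card_insert_of_notMem hpT, Finset.card_insert_of_notMem hqT]; omega)
    (fun g _ => hf g)
  have key : ∀ x ∈ insert p (insert q T), ∀ y ∈ insert p (insert q T), x < y → f x = f y →
      I.Split a n E (G \ {p, q}) := by
    intro x hx y hy hxy he
    refine hP.split_of_dominates hJ hE (hf x)
      (Finset.insert_subset hT.hp (Finset.singleton_subset_iff.2 hT.hq))
      (Dominates.of_pair (hfm x (hsubG hx)) (he ▸ hfm y (hsubG hy)) hxy.ne ?_ ?_)
    · have hpq := hT.hpq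
      simp only [Finset.mem_insert] at hx hy
      rcases hx with rfl | rfl | hx
      · exact le_rfl
      · rcases hy with rfl | rfl | hy
        · omega
        · omega
        · have := hT.lt y hy
          omega
      · exact (hT.lt x hx).le
    · have hpq := hT.hpq
      simp only [Finset.mem_insert] at hy
      rcases hy with rfl | rfl | hy
      · omega
      · exact le_rfl
      · have := hT.lt y hy
        omega
  rcases lt_or_gt_of_ne hxy with hlt | hlt
  · exact key x hx y hy hlt he
  · exact key y hy x hx hlt he.symm

/-- `a` likes only sets of at least two goods. -/
def NeedsTwo (I : OrderedInstance ι) (a : ι) (G : Finset ℕ) : Prop :=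
  ∀ S ⊆ G, I.Likes a S → 2 ≤ S.card

theorem NeedsTwo.mono {a : ι} {G H : Finset ℕ} (h : I.NeedsTwo a H) (hG : G ⊆ H) :
    I.NeedsTwo a G := fun S hS => h S (hS.trans hG)

/-- `a` has a splitting in which one bundle consists of `τ` and another good. -/
def PairSplit (I : OrderedInstance ι) (a : ι) (n E : ℕ) (G : Finset ℕ) (τ : ℕ) : Prop :=
  ∃ J P, I.IsPacking a G J P ∧ J.card = n ∧ ∑ j ∈ J, ((P j).card - 2) ≤ E ∧
    ∃ j ∈ J, ∃ x, x ≠ τ ∧ P j = {τ, x}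

theorem IsPacking.sub_le_card_filter {a : ι} {n E : ℕ} {G J : Finset ℕ} {P : ℕ → Finset ℕ}
    (hP : I.IsPacking a G J P) (hn : J.card = n) (hE : ∑ j ∈ J, ((P j).card - 2) ≤ E)
    (h2 : I.NeedsTwo a G) : n ≤ (J.filter fun j => (P j).card = 2).card + E := by
  have h1 : (J.filter fun j => ¬ (P j).card = 2).card ≤ ∑ j ∈ J, ((P j).card - 2) := by
    rw [Finset.card_filter]
    refine Finset.sum_le_sum fun j hj => ?_
    have := h2 _ (hP.sub j hj) (hP.likes j hj)
    split_ifs <;> omega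
  have h3 := Finset.card_filter_add_card_filter_not (s := J) (fun j => (P j).card = 2)
  omega

/-- All but few of the best goods are contained in a bundle of two goods. -/
theorem IsPacking.exists_pairs {a : ι} {G J T : Finset ℕ} {P : ℕ → Finset ℕ} {p q : ℕ}
    (hP : I.IsPacking a G J P) (hT : IsStart G T p q) (hd : ¬ I.Likes a {p, q}) :
    ∃ D ⊆ T, D.card + (J.filter fun j => (P j).card = 2).card ≤ T.card ∧
      ∀ τ ∈ T, τ ∉ D → ∃ j ∈ J, ∃ x, x ≠ τ ∧ P j = {τ, x} := by
  classical
  set D := T.filter fun τ => ¬ ∃ j ∈ J, ∃ x, x ≠ τ ∧ P j = {τ, x} with hDdef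
  refine ⟨D, Finset.filter_subset _ _, ?_, fun τ hτ hτD => ?_⟩
  · have hex : ∀ j ∈ J.filter (fun j => (P j).card = 2), ∃ τ ∈ T, ∃ x, x ≠ τ ∧ P j = {τ, x} := by
      intro j hj
      obtain ⟨hjJ, hj2⟩ := Finset.mem_filter.1 hj
      obtain ⟨x, y, hxy, hPj⟩ := Finset.card_eq_two.1 hj2
      by_cases hx : x ∈ T
      · exact ⟨x, hx, y, hxy.symm, hPj⟩
      by_cases hy : y ∈ T
      · exact ⟨y, hy, x, hxy, by rw [hPj, Finset.pair_comm]⟩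
      exfalso
      have hl := hP.likes j hjJ
      have hxG : x ∈ G := hP.sub j hjJ (by rw [hPj]; simp)
      have hyG : y ∈ G := hP.sub j hjJ (by rw [hPj]; simp)
      have h1 := hT.le x hxG hx
      have h2 := hT.le y hyG hy
      have hpq := hT.hpq
      rw [hPj] at hl
      rcases lt_or_gt_of_ne hxy with h | h
      · exact hd (hl.of_dominates (Dominates.of_pair (a := p) (b := q) (by simp) (by simp)
          hpq.ne (by omega) (by omega)))
      · rw [Finset.pair_comm] at hl
        exact hd (hl.of_dominates (Dominates.of_pair (a := p) (b := q) (by simp) (by simp)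
          hpq.ne (by omega) (by omega)))
    have hchoose : ∀ j, ∃ τ, j ∈ J.filter (fun j => (P j).card = 2) →
        τ ∈ T ∧ ∃ x, x ≠ τ ∧ P j = {τ, x} := by
      intro j
      by_cases hj : j ∈ J.filter (fun j => (P j).card = 2)
      · obtain ⟨τ, hτ⟩ := hex j hj
        exact ⟨τ, fun _ => hτ⟩
      · exact ⟨0, fun h => absurd h hj⟩
    choose f hf using hchoose
    have hle : (J.filter fun j => (P j).card = 2).card ≤ (T \ D).card := by
      refine Finset.card_le_card_of_injOn f ?_ ?_
      · intro j hj
        obtain ⟨h1, h2⟩ := hf j hj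
        refine Finset.mem_sdiff.2 ⟨h1, fun hD => ?_⟩
        exact (Finset.mem_filter.1 hD).2 ⟨j, (Finset.mem_filter.1 hj).1, h2⟩
      · intro i hi j hj he
        by_contra hij
        obtain ⟨-, x, -, h2⟩ := hf i hi
        obtain ⟨-, y, -, h3⟩ := hf j hj
        exact Finset.disjoint_left.1 (hP.disj i (Finset.mem_filter.1 hi).1 j
          (Finset.mem_filter.1 hj).1 hij) (by rw [h2]; simp : f i ∈ P i)
          (by rw [h3, he]; simp)
    rw [Finset.card_sdiff_of_subset (hDdef ▸ Finset.filter_subset _ _)] at hle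
    have : D.card ≤ T.card := Finset.card_le_card (Finset.filter_subset _ _)
    omega
  · by_contra hcon
    exact hτD (Finset.mem_filter.2 ⟨hτ, hcon⟩)

theorem Split.exists_pairSplit {a : ι} {n E : ℕ} {G T : Finset ℕ} {p q : ℕ}
    (h : I.Split a n E G) (h2 : I.NeedsTwo a G) (hT : IsStart G T p q)
    (hd : ¬ I.Likes a {p, q}) :
    ∃ D ⊆ T, D.card + n ≤ T.card + E ∧ ∀ τ ∈ T, τ ∉ D → I.PairSplit a n E G τ := by
  obtain ⟨J, P, hP, hn, hE⟩ := h
  obtain ⟨D, hD, hc, hD'⟩ := hP.exists_pairs hT hd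
  have := hP.sub_le_card_filter hn hE h2
  exact ⟨D, hD, by omega, fun τ hτ hτD => ⟨J, P, hP, hn, hE, hD' τ hτ hτD⟩⟩

/-- Her own pair `{τ, x}` satisfies `x ≤ y` and hence dominates `{τ, y}`: only this bundle is lost.
-/
theorem PairSplit.split {a : ι} {n E : ℕ} {G : Finset ℕ} {τ y : ℕ}
    (h : I.PairSplit a (n + 1) E G τ) (hτ : τ ∈ G) (hy : y ∈ G)
    (hmax : ∀ x ∈ G, x ≠ τ → I.Likes a {τ, x} → x ≤ y) : I.Split a n E (G \ {τ, y}) := by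
  obtain ⟨J, P, hP, hn, hE, j, hj, x, hx, hPj⟩ := h
  have hxG : x ∈ G := hP.sub j hj (by rw [hPj]; simp)
  have hl := hP.likes j hj
  rw [hPj] at hl
  refine hP.split_of_dominates hn hE hj (Finset.insert_subset hτ (Finset.singleton_subset_iff.2 hy))
    (Dominates.mono ?_ Finset.subset_union_left)
  rw [hPj]
  exact Dominates.of_pair (by simp) (by simp) hx.symm le_rfl (hmax x hxG hx hl)

theorem exists_max_pair {A : Finset ι} {G : Finset ℕ} {τ : ℕ}
    (h : ∃ a ∈ A, ∃ x ∈ G, x ≠ τ ∧ I.Likes a {τ, x}) :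
    ∃ y ∈ G, y ≠ τ ∧ (∃ a ∈ A, I.Likes a {τ, y}) ∧
      ∀ a ∈ A, ∀ x ∈ G, x ≠ τ → I.Likes a {τ, x} → x ≤ y := by
  classical
  obtain ⟨a, ha, x, hx, hxτ, hl⟩ := h
  have hne : (G.filter fun x => x ≠ τ ∧ ∃ a ∈ A, I.Likes a {τ, x}).Nonempty :=
    ⟨x, Finset.mem_filter.2 ⟨hx, hxτ, a, ha, hl⟩⟩
  obtain ⟨y, hy, hmax⟩ := Finset.exists_max_image _ id hne
  obtain ⟨h1, h2, h3⟩ := Finset.mem_filter.1 hy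
  exact ⟨y, h1, h2, h3, fun a ha x hx hxτ hl =>
    hmax x (Finset.mem_filter.2 ⟨hx, hxτ, a, ha, hl⟩)⟩

theorem PairSplit.exists_likes {a : ι} {n E : ℕ} {G : Finset ℕ} {τ : ℕ}
    (h : I.PairSplit a n E G τ) : ∃ x ∈ G, x ≠ τ ∧ I.Likes a {τ, x} := by
  obtain ⟨J, P, hP, hn, hE, j, hj, x, hx, hPj⟩ := h
  refine ⟨x, hP.sub j hj (by rw [hPj]; simp), hx, ?_⟩
  rw [← hPj]
  exact hP.likes j hj

theorem Split.two_mul_le_card {a : ι} {n E : ℕ} {G : Finset ℕ} (h : I.Split a n E G)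
    (h2 : I.NeedsTwo a G) : 2 * n ≤ G.card := by
  obtain ⟨J, P, hP, hn, hE⟩ := h
  calc 2 * n = ∑ j ∈ J, 2 := by rw [Finset.sum_const, hn]; simp [mul_comm]
    _ ≤ ∑ j ∈ J, (P j).card := Finset.sum_le_sum fun j hj => h2 _ (hP.sub j hj) (hP.likes j hj)
    _ = (J.biUnion P).card := (Finset.card_biUnion fun i hi j hj hij => hP.disj i hi j hj hij).symm
    _ ≤ G.card := Finset.card_le_card (Finset.biUnion_subset.2 hP.sub)

theorem Split.solvable_one {a : ι} {E : ℕ} {G : Finset ℕ} (h : I.Split a 1 E G) :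
    I.Solvable {a} G := by
  obtain ⟨J, P, hP, hn, -⟩ := h
  obtain ⟨j, hj⟩ : J.Nonempty := Finset.card_pos.1 (by omega)
  exact (solvable_singleton (hP.likes j hj)).mono (hP.sub j hj)

theorem Split.exists_two {a : ι} {E : ℕ} {G : Finset ℕ} (h : I.Split a 2 E G) :
    ∃ X Y, X ⊆ G ∧ Y ⊆ G ∧ Disjoint X Y ∧ I.Likes a X ∧ I.Likes a Y := by
  obtain ⟨J, P, hP, hn, -⟩ := h
  obtain ⟨i, j, hij, rfl⟩ := Finset.card_eq_two.1 hn
  exact ⟨P i, P j, hP.sub i (by simp), hP.sub j (by simp), hP.disj i (by simp) j (by simp) hij,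
    hP.likes i (by simp), hP.likes j (by simp)⟩

theorem Split.solvable_two [DecidableEq ι] {a b : ι} {E E' : ℕ} {G : Finset ℕ}
    (ha : I.Split a 2 E G) (hb : I.Split b 2 E' G) : I.Solvable {a, b} G := by
  obtain ⟨X, Y, hX, hY, hXY, hlX, hlY⟩ := ha.exists_two
  obtain ⟨X', Y', hX', hY', hXY', hlX', hlY'⟩ := hb.exists_two
  have hb2 : 2 * I.mu b ≤ I.val b G := by
    have := val_mono (I := I) (a := b) (Finset.union_subset hX' hY')
    rw [val_union hXY'] at this
    simp only [Likes] at hlX' hlY'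
    linarith
  rcases likes_or_likes_sdiff hX hb2 with h | h
  · rw [Finset.pair_comm]
    have : Y ⊆ G \ X := fun y hy => Finset.mem_sdiff.2 ⟨hY hy, Finset.disjoint_right.1 hXY hy⟩
    exact ((solvable_singleton (hlY.mono this))).insert hX h
  · have := (solvable_singleton h).insert hX hlX
    exact this

/-- If each of `n` agents can split `G` into `n` liked bundles with total excess at most two, all of
them can be satisfied. -/
theorem solvable_of_split_two {n : ℕ} {A : Finset ι} {G : Finset ℕ} (hA : A.card = n)
    (h2 : ∀ a ∈ A, I.NeedsTwo a G) (hs : ∀ a ∈ A, I.Split a n 2 G) : I.Solvable A G := by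
  classical
  induction n generalizing A G with
  | zero =>
    rw [Finset.card_eq_zero] at hA
    subst hA
    exact ⟨fun _ => ∅, by simp, by simp⟩
  | succ n ih =>
  obtain ⟨a₀, ha₀⟩ : A.Nonempty := Finset.card_pos.1 (by omega)
  rcases Nat.lt_or_ge n 2 with hn | hn
  · interval_cases n
    · obtain ⟨a, rfl⟩ := Finset.card_eq_one.1 hA
      exact (hs a (by simp)).solvable_one
    · obtain ⟨a, b, hab, rfl⟩ := Finset.card_eq_two.1 hA
      exact (hs a (by simp)).solvable_two (hs b (by simp))
  have hG := (hs a₀ ha₀).two_mul_le_card (h2 a₀ ha₀)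
  obtain ⟨T, p, q, hTc, hT⟩ := exists_isStart (G := G) (k := n) (by omega)
  have step : ∀ a ∈ A, ∀ S ⊆ G, I.Likes a S → (∀ b ∈ A, b ≠ a → I.Split b n 2 (G \ S)) →
      I.Solvable A G := by
    intro a ha S hS hl hsp
    have := ih (A := A.erase a) (G := G \ S) (by rw [Finset.card_erase_of_mem ha, hA]; rfl)
      (fun b hb => (h2 b (Finset.mem_of_mem_erase hb)).mono Finset.sdiff_subset)
      fun b hb => hsp b (Finset.mem_of_mem_erase hb) (Finset.ne_of_mem_erase hb)
    have := this.insert hS hl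
    rwa [Finset.insert_erase ha] at this
  by_cases hpq : ∃ a ∈ A, I.Likes a {p, q}
  · obtain ⟨a, ha, hl⟩ := hpq
    exact step a ha _ (Finset.insert_subset hT.hp (Finset.singleton_subset_iff.2 hT.hq)) hl
      fun b hb _ => (hs b hb).sdiff_start hT hTc
  push Not at hpq
  have hD : ∀ a, ∃ D ⊆ T, a ∈ A → D.card ≤ 1 ∧ ∀ τ ∈ T, τ ∉ D → I.PairSplit a (n + 1) 2 G τ := by
    intro a
    by_cases ha : a ∈ A
    · obtain ⟨D, hDT, hc, hD⟩ := (hs a ha).exists_pairSplit (h2 a ha) hT (hpq a ha)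
      exact ⟨D, hDT, fun _ => ⟨by omega, hD⟩⟩
    · exact ⟨∅, by simp, fun h => absurd h ha⟩
  choose D hDT hD using hD
  -- Each of the `n + 1` agents has at most one bad good in `T`. As `n + 1 < 2 * n`, some good of
  -- `T` is bad for at most one agent.
  obtain ⟨τ, hτ, hbad⟩ : ∃ τ ∈ T, (A.filter fun a => τ ∈ D a).card ≤ 1 := by
    by_contra! hcon
    have h1 := Finset.sum_card_bipartiteAbove_eq_sum_card_bipartiteBelow (s := T) (t := A)
      (r := fun τ a => τ ∈ D a)
    have h3 : T.card • 2 ≤ ∑ τ ∈ T, (A.filter fun a => τ ∈ D a).card :=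
      Finset.card_nsmul_le_sum _ _ _ fun τ hτ => hcon τ hτ
    rw [smul_eq_mul] at h3
    have h4 : ∑ a ∈ A, (T.filter fun τ => τ ∈ D a).card ≤ A.card • 1 :=
      Finset.sum_le_card_nsmul _ _ _ fun a ha => by
        rw [Finset.filter_mem_eq_inter, Finset.inter_eq_right.2 (hDT a)]
        exact (hD a ha).1
    rw [smul_eq_mul] at h4
    simp only [Finset.bipartiteAbove, Finset.bipartiteBelow] at h1
    omega
  have hgood : ∃ a ∈ A, τ ∉ D a := by
    by_contra! hcon
    rw [Finset.filter_true_of_mem hcon] at hbad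
    omega
  obtain ⟨y, hyG, hyτ, ⟨a, ha, hla⟩, hmax⟩ := exists_max_pair (I := I) (A := A) (G := G) (τ := τ) <| by
    obtain ⟨a, ha, haD⟩ := hgood
    exact ⟨a, ha, ((hD a ha).2 τ hτ haD).exists_likes⟩
  have hτG := hT.sub hτ
  have hS : ({τ, y} : Finset ℕ) ⊆ G :=
    Finset.insert_subset hτG (Finset.singleton_subset_iff.2 hyG)
  have good : ∀ b ∈ A, τ ∉ D b → I.Split b n 2 (G \ {τ, y}) := fun b hb hbD =>
    ((hD b hb).2 τ hτ hbD).split hτG hyG (hmax b hb)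
  -- The possible bad agent either likes `{τ, y}` and receives it, or dislikes it and loses only one
  -- bundle by `Split.sdiff_pair`. All others lose one bundle because `y` is the worst partner of
  -- `τ` that anybody accepts.
  by_cases hb : ∃ b ∈ A, τ ∈ D b ∧ I.Likes b {τ, y}
  · obtain ⟨b, hb, hbD, hlb⟩ := hb
    refine step b hb _ hS hlb fun c hc hcb => good c hc fun hcD => hcb ?_
    exact Finset.card_le_one.1 hbad c (Finset.mem_filter.2 ⟨hc, hcD⟩) b
      (Finset.mem_filter.2 ⟨hb, hbD⟩)
  · push Not at hb
    refine step a ha _ hS hla fun c hc _ => ?_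
    by_cases hcD : τ ∈ D c
    · exact (hs c hc).sdiff_pair (hb c hc hcD)
    · exact good c hc hcD

theorem Solvable.of_sdiff {A X : Finset ι} {G H K : Finset ℕ} [DecidableEq ι] (hX : X ⊆ A)
    (h : I.Solvable X G) (h' : I.Solvable (A \ X) H) (hGH : Disjoint G H) (hK : G ∪ H ⊆ K) :
    I.Solvable A K := by
  have := h.union h' hGH
  rw [Finset.union_sdiff_of_subset hX] at this
  exact this.mono hK

/-- Goods outside the bundles are added to the first one; the other two are kept unchanged so that
their sizes remain known. -/
theorem IsPacking.exists_division {a : ι} {G : Finset ℕ} {P : ℕ → Finset ℕ} {i j k : ℕ}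
    (hij : i ≠ j) (hik : i ≠ k) (hjk : j ≠ k) (h : I.IsPacking a G {i, j, k} P) :
    ∃ P', I.IsDivision a G P' ∧ P' 1 = P j ∧ P' 2 = P k := by
  have hi : i ∈ ({i, j, k} : Finset ℕ) := by simp
  have hj : j ∈ ({i, j, k} : Finset ℕ) := by simp
  have hk : k ∈ ({i, j, k} : Finset ℕ) := by simp
  have d1 := h.disj i hi j hj hij
  have d2 := h.disj i hi k hk hik
  have d3 := h.disj j hj k hk hjk
  have s1 : P i ⊆ G \ (P j ∪ P k) := fun x hx => Finset.mem_sdiff.2 ⟨h.sub i hi hx, fun hx' =>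
    (Finset.mem_union.1 hx').elim (Finset.disjoint_left.1 d1 hx) (Finset.disjoint_left.1 d2 hx)⟩
  refine ⟨![G \ (P j ∪ P k), P j, P k], ⟨?_, ?_, ?_⟩, rfl, rfl⟩
  · have : (Finset.univ : Finset (Fin 3)) = {0, 1, 2} := by decide
    rw [this, Finset.biUnion_insert, Finset.biUnion_insert, Finset.singleton_biUnion]
    exact Finset.sdiff_union_of_subset (Finset.union_subset (h.sub j hj) (h.sub k hk))
  · have e1 : Disjoint (G \ (P j ∪ P k)) (P j) :=
      Finset.disjoint_of_subset_right Finset.subset_union_left Finset.sdiff_disjoint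
    have e2 : Disjoint (G \ (P j ∪ P k)) (P k) :=
      Finset.disjoint_of_subset_right Finset.subset_union_right Finset.sdiff_disjoint
    intro x y hxy
    fin_cases x <;> fin_cases y <;> first
      | exact absurd rfl hxy
      | assumption
      | (rw [disjoint_comm]; assumption)
  · intro x
    fin_cases x
    · exact (h.likes i hi).mono s1
    · exact h.likes j hj
    · exact h.likes k hk

theorem Split.exists_division {a : ι} {E : ℕ} {G : Finset ℕ} (h : I.Split a 3 E G) :
    ∃ P, I.IsDivision a G P := by
  obtain ⟨J, P, hP, hn, -⟩ := h
  obtain ⟨i, j, k, hij, hik, hjk, rfl⟩ := Finset.card_eq_three.1 hn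
  obtain ⟨P', hP', -⟩ := IsPacking.exists_division hij hik hjk hP
  exact ⟨P', hP'⟩

/-- Excess one allows only one bundle of more than two goods, and this one is chosen to absorb the
unused goods. -/
theorem Split.exists_division_pairs {a : ι} {G : Finset ℕ} (h : I.Split a 3 1 G) :
    ∃ P, I.IsDivision a G P ∧ (P 1).card ≤ 2 ∧ (P 2).card ≤ 2 := by
  obtain ⟨J, P, hP, hn, hE⟩ := h
  obtain ⟨i, j, k, hij, hik, hjk, rfl⟩ := Finset.card_eq_three.1 hn
  rw [Finset.sum_insert (by simp [hij, hik]), Finset.sum_pair hjk] at hE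
  by_cases h1 : (P j).card ≤ 2 ∧ (P k).card ≤ 2
  · obtain ⟨P', hP', e1, e2⟩ := IsPacking.exists_division hij hik hjk hP
    exact ⟨P', hP', e1 ▸ h1.1, e2 ▸ h1.2⟩
  by_cases h2 : (P i).card ≤ 2 ∧ (P k).card ≤ 2
  · obtain ⟨P', hP', e1, e2⟩ := IsPacking.exists_division hij.symm hjk hik
      (by rwa [Finset.insert_comm] at hP)
    exact ⟨P', hP', e1 ▸ h2.1, e2 ▸ h2.2⟩
  have h3 : (P i).card ≤ 2 ∧ (P j).card ≤ 2 := by omega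
  obtain ⟨P', hP', e1, e2⟩ := IsPacking.exists_division hik.symm hjk.symm hij
    (by rwa [show ({i, j, k} : Finset ℕ) = {k, i, j} by grind] at hP)
  exact ⟨P', hP', e1 ▸ h3.1, e2 ▸ h3.2⟩

/-- `a` has a splitting into four bundles: `τ` with another good and three triples. -/
def TripleSplit (I : OrderedInstance ι) (a : ι) (G : Finset ℕ) (τ : ℕ) : Prop :=
  ∃ J P, I.IsPacking a G J P ∧ J.card = 4 ∧
    ∃ j ∈ J, (∃ x, x ≠ τ ∧ P j = {τ, x}) ∧ ∀ i ∈ J, i ≠ j → (P i).card = 3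

theorem TripleSplit.exists_division {a : ι} {G : Finset ℕ} {τ y : ℕ} (h : I.TripleSplit a G τ)
    (hG : (G \ {τ, y}).card = 9) (hτ : τ ∈ G) (hy : y ∈ G)
    (hmax : ∀ x ∈ G, x ≠ τ → I.Likes a {τ, x} → x ≤ y) :
    ∃ P, I.IsDivision a (G \ {τ, y}) P ∧ ∀ j, (P j).card = 3 := by
  obtain ⟨J, P, hP, hn, j, hj, ⟨x, hx, hPj⟩, h3⟩ := h
  have hxG : x ∈ G := hP.sub j hj (by rw [hPj]; simp)
  have hl := hP.likes j hj
  rw [hPj] at hl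
  obtain ⟨P', hP', hc⟩ := hP.remove_of_dominates_extended (S := {τ, y}) hj
    (Finset.insert_subset hτ (Finset.singleton_subset_iff.2 hy)) (Dominates.mono (by
      rw [hPj]
      exact Dominates.of_pair (by simp) (by simp) hx.symm le_rfl (hmax x hxG hx hl) :
        Dominates (P j) _) Finset.subset_union_left)
  obtain ⟨a₁, a₂, a₃, n12, n13, n23, hJ⟩ := Finset.card_eq_three.1
    (by rw [Finset.card_erase_of_mem hj, hn] : (J.erase j).card = 3)
  have hc3 : ∀ i ∈ J.erase j, (P' i).card = 3 := fun i hi => by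
    rw [hc i hi]
    exact h3 i (Finset.mem_of_mem_erase hi) (Finset.ne_of_mem_erase hi)
  rw [hJ] at hP' hc3
  obtain ⟨Q, hQ, e1, e2⟩ := IsPacking.exists_division n12 n13 n23 hP'
  have hE := hQ.card_eq
  rw [Fin.sum_univ_three, hG, e1, e2, hc3 _ (by simp), hc3 _ (by simp)] at hE
  refine ⟨Q, hQ, fun i => ?_⟩
  fin_cases i
  · simp only [Fin.zero_eta]; omega
  · simp only [Fin.mk_one, e1]; exact hc3 _ (by simp)
  · simp only [Fin.reduceFinMk, e2]; exact hc3 _ (by simp)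

/-! ### Single goods and the residual problem with three bundles. -/

/-- Handing out single goods, the worst one first. -/
theorem exists_solvable_singles {B : Finset ι} {s r : ℕ} {k : ι → ℕ}
    (hk : ∀ b ∈ B, ∀ j < k b, I.Likes b {j})
    (h : ∀ j < r, r ≤ (B.filter fun b => s + j < k b).card + j) :
    ∃ X ⊆ B, X.card = r ∧ I.Solvable X (Finset.Ico s (s + r)) := by
  classical
  induction r generalizing B with
  | zero => exact ⟨∅, by simp, rfl, fun _ => ∅, by simp, by simp⟩
  | succ r ih =>
    -- The condition for the last good provides a taker. Her departure lowers every other count by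
    -- at most one, and one good fewer is needed.
    obtain ⟨b, hb⟩ : (B.filter fun b => s + r < k b).Nonempty := by
      rw [← Finset.card_pos]
      have := h r (by omega)
      omega
    obtain ⟨hbB, hbk⟩ := Finset.mem_filter.1 hb
    obtain ⟨X, hX, hc, hs⟩ := ih (B := B.erase b) (fun c hc => hk c (Finset.mem_of_mem_erase hc))
      fun j hj => by
        have h1 := h j (by omega)
        rw [Finset.filter_erase]
        have := Finset.pred_card_le_card_erase (s := B.filter fun b => s + j < k b) (a := b)
        omega
    have hbX : b ∉ X := fun hbX => Finset.notMem_erase b B (hX hbX)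
    refine ⟨insert b X, Finset.insert_subset hbB (hX.trans (Finset.erase_subset _ _)),
      by rw [Finset.card_insert_of_notMem hbX, hc], ?_⟩
    refine Solvable.insert (S := {s + r}) ?_ (by simp) (hk b hbB _ hbk)
    refine hs.mono fun x hx => ?_
    simp only [Finset.mem_sdiff, Finset.mem_Ico, Finset.mem_singleton] at hx ⊢
    omega

theorem solvable_singles {B : Finset ι} {s r : ℕ} {k : ι → ℕ}
    (hk : ∀ b ∈ B, ∀ j < k b, I.Likes b {j}) (hB : B.card = r) (h : ∀ b ∈ B, s + r ≤ k b) :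
    I.Solvable B (Finset.Ico s (s + r)) := by
  obtain ⟨X, hX, hc, hs⟩ := exists_solvable_singles (B := B) (s := s) (r := r) hk fun j hj => by
    rw [Finset.filter_true_of_mem fun b hb => by have := h b hb; omega]
    omega
  rwa [Finset.eq_of_subset_of_card_le hX (by omega)] at hs

/-- The agents `B` and the goods `Ico 0 u ∪ Ico t 15` that remain after as many agents as possible
received single goods. Agent `b` likes the first `k b` goods, and no single good in `Ico t 15`. -/
structure Residual (I : OrderedInstance ι) (B : Finset ι) (k : ι → ℕ) (n u t : ℕ) : Prop where
  card : B.card = n + u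
  likes : ∀ b ∈ B, ∀ j < k b, I.Likes b {j}
  one_le : ∀ b ∈ B, 1 ≤ k b
  le_u : ∀ b ∈ B, k b ≤ u
  count : ∀ j < u, u + 1 ≤ (B.filter fun b => j < k b).card + j
  split : ∀ b ∈ B, I.Split b n (k b - 1) (Finset.Ico t 15)
  needsTwo : ∀ b ∈ B, I.NeedsTwo b (Finset.Ico t 15)

namespace Residual

variable {B : Finset ι} {k : ι → ℕ} {n u t : ℕ}

theorem exists_singles (h : I.Residual B k n u t) :
    ∃ X ⊆ B, X.card = u ∧ I.Solvable X (Finset.Ico 0 u) := by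
  have := exists_solvable_singles (s := 0) (r := u) h.likes fun j hj => by
    have := h.count j hj
    simp only [zero_add]
    omega
  rwa [zero_add] at this

theorem solvable_of_forall_split (h : I.Residual B k n u t) (hut : u ≤ t)
    (hn : ∀ X ⊆ B, X.card = n → I.Solvable X (Finset.Ico t 15)) :
    I.Solvable B (Finset.Ico 0 u ∪ Finset.Ico t 15) := by
  classical
  obtain ⟨X, hX, hc, hs⟩ := h.exists_singles
  refine Solvable.of_sdiff hX hs (hn _ Finset.sdiff_subset ?_) ?_ subset_rfl
  · rw [Finset.card_sdiff_of_subset hX, hc, h.card]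
    omega
  · rw [Finset.disjoint_left]
    intro x hx
    simp only [Finset.mem_Ico] at hx ⊢
    omega

theorem solvable_of_le_two (h : I.Residual B k n u t) (hut : u ≤ t) (hn : n ≤ 2) :
    I.Solvable B (Finset.Ico 0 u ∪ Finset.Ico t 15) := by
  classical
  refine h.solvable_of_forall_split hut fun X hX hc => ?_
  interval_cases n
  · rw [Finset.card_eq_zero] at hc
    subst hc
    exact ⟨fun _ => ∅, by simp, by simp⟩
  · obtain ⟨a, rfl⟩ := Finset.card_eq_one.1 hc
    exact (h.split a (hX (by simp))).solvable_one
  · obtain ⟨a, b, hab, rfl⟩ := Finset.card_eq_two.1 hc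
    exact (h.split a (hX (by simp))).solvable_two (h.split b (hX (by simp)))

theorem solvable_of_u_le_three (h : I.Residual B k n u t) (hut : u ≤ t) (hu : u ≤ 3) :
    I.Solvable B (Finset.Ico 0 u ∪ Finset.Ico t 15) := by
  refine h.solvable_of_forall_split hut fun X hX hc => ?_
  exact solvable_of_split_two hc (fun a ha => h.needsTwo a (hX ha)) fun a ha =>
    (h.split a (hX ha)).mono (by have := h.le_u a (hX ha); omega) subset_rfl

/-- An agent with `k x ≤ 2` has excess at most one, thus two small bundles, and can be kept for the
tail because `count` leaves one agent to spare. If there is none, everybody likes the goods `0, 1,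
2`, so any three agents may be left for these goods. -/
theorem solvable_of_eq_three (h : I.Residual B k 3 u 5) (hu : u = 4 ∨ u = 5) :
    I.Solvable B (Finset.Ico 0 u ∪ Finset.Ico 5 15) := by
  classical
  by_cases hx : ∃ x ∈ B, k x ≤ 2
  · obtain ⟨x, hxB, hxk⟩ := hx
    obtain ⟨X, hX, hc, hs⟩ := exists_solvable_singles (B := B.erase x) (s := 0) (r := u)
      (fun b hb => h.likes b (Finset.mem_of_mem_erase hb)) fun j hj => by
        have h1 := h.count j hj
        simp only [zero_add]
        rw [Finset.filter_erase]
        have := Finset.pred_card_le_card_erase (s := B.filter fun b => j < k b) (a := x)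
        omega
    rw [zero_add] at hs
    have hXB := hX.trans (Finset.erase_subset _ _)
    have hR : (B \ X).card = 3 := by
      rw [Finset.card_sdiff_of_subset hXB, hc, h.card]
      omega
    obtain ⟨P, hP, h1, h2⟩ := ((h.split x hxB).mono (E' := 1) (by omega)
      subset_rfl).exists_division_pairs
    refine Solvable.of_sdiff hXB hs (exists_solvable_of_two_pairs hR (fun a ha =>
      (h.split a (Finset.sdiff_subset ha)).exists_division) (x := x) ?_ hP (i := 1) (j := 2)
      (by decide) h1 h2) ?_ subset_rfl
    · exact Finset.mem_sdiff.2 ⟨hxB, fun hxX => Finset.notMem_erase x B (hX hxX)⟩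
    · rw [Finset.disjoint_left]
      intro x hx
      simp only [Finset.mem_Ico] at hx ⊢
      omega
  · push Not at hx
    -- The goods from `3` on go to `u - 3` agents. Of the six that remain, three are satisfied with
    -- the ten tail goods and three take `0, 1, 2`.
    obtain ⟨Z, hZ, hZc, hZs⟩ := exists_solvable_singles (s := 3) (r := u - 3) h.likes fun j hj => by
      have := h.count (3 + j) (by omega)
      omega
    have c1 : (B \ Z).card = 6 := by
      rw [Finset.card_sdiff_of_subset hZ, hZc, h.card]
      omega
    obtain ⟨X, hX, hXc, hXs⟩ := exists_solvable_of_card_eq_ten c1.ge fun a ha =>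
      (h.split a (Finset.sdiff_subset ha)).exists_division
    have c2 : ((B \ Z) \ X).card = 3 := by
      rw [Finset.card_sdiff_of_subset hX, hXc, c1]
    have hsub : ∀ b ∈ (B \ Z) \ X, b ∈ B := fun b hb => Finset.sdiff_subset (Finset.sdiff_subset hb)
    have hW := solvable_singles (s := 0) (fun b hb => h.likes b (hsub b hb)) c2 fun b hb => by
      have := hx b (hsub b hb)
      omega
    refine Solvable.of_sdiff hZ hZs (Solvable.of_sdiff hX hXs hW ?_ subset_rfl) ?_ ?_
    · rw [Finset.disjoint_left]
      intro x hx
      simp only [Finset.mem_Ico] at hx ⊢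
      omega
    · rw [Finset.disjoint_left]
      intro x hx
      simp only [Finset.mem_Ico, Finset.mem_union] at hx ⊢
      omega
    · intro x hx
      simp only [Finset.mem_Ico, Finset.mem_union] at hx ⊢
      omega

end Residual

/-! ### The residual problem with four bundles on eleven goods. -/

/-- Either `a` has at least two bundles of two goods, or the other three bundles are triples. -/
theorem Split.exists_pairSplit_or_tripleSplit {a : ι} {E : ℕ} {G T : Finset ℕ} {p q : ℕ}
    (h : I.Split a 4 E G) (hE3 : E ≤ 3) (h2 : I.NeedsTwo a G) (hT : IsStart G T p q)
    (hT3 : T.card = 3) (hd : ¬ I.Likes a {p, q}) :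
    ∃ D ⊆ T, D.card ≤ 2 ∧ (∀ τ ∈ T, τ ∉ D → I.PairSplit a 4 3 G τ) ∧
      (1 < D.card → E = 3 ∧ ∀ τ ∈ T, τ ∉ D → I.TripleSplit a G τ) := by
  obtain ⟨J, P, hP, hn, hE⟩ := h
  obtain ⟨D, hD, hc, hD'⟩ := hP.exists_pairs hT hd
  have h4 := hP.sub_le_card_filter hn hE h2
  refine ⟨D, hD, by omega, fun τ hτ hτD => ⟨J, P, hP, hn, hE.trans hE3, hD' τ hτ hτD⟩,
    -- Two missed goods of `T` leave room for at most one bundle of two goods. The other three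
    -- bundles have excess at least one each and at most three together, so they are triples.
    fun h1 => ⟨by omega, fun τ hτ hτD => ?_⟩⟩
  obtain ⟨j, hj, x, hx, hPj⟩ := hD' τ hτ hτD
  refine ⟨J, P, hP, hn, j, hj, ⟨x, hx, hPj⟩, ?_⟩
  have hj2 : (P j).card = 2 := by rw [hPj]; exact Finset.card_pair hx.symm
  have hge : ∀ i ∈ J, i ≠ j → 3 ≤ (P i).card := by
    intro i hi hij
    by_contra hlt
    have := h2 _ (hP.sub i hi) (hP.likes i hi)
    have : 2 ≤ (J.filter fun j => (P j).card = 2).card := by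
      refine (Finset.card_pair hij).ge.trans (Finset.card_le_card fun g hg => ?_)
      simp only [Finset.mem_insert, Finset.mem_singleton] at hg
      rcases hg with e | e
      · exact Finset.mem_filter.2 ⟨e ▸ hi, by rw [e]; omega⟩
      · exact Finset.mem_filter.2 ⟨e ▸ hj, by rw [e]; exact hj2⟩
    omega
  intro i hi hij
  have hije : i ∈ J.erase j := Finset.mem_erase.2 ⟨hij, hi⟩
  have hce : ((J.erase j).erase i).card = 2 := by
    rw [Finset.card_erase_of_mem hije, Finset.card_erase_of_mem hj, hn]
  rw [← Finset.add_sum_erase _ _ hj, ← Finset.add_sum_erase _ _ hije] at hE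
  have : ((J.erase j).erase i).card • 1 ≤ ∑ x ∈ (J.erase j).erase i, ((P x).card - 2) :=
    Finset.card_nsmul_le_sum _ _ _ fun x hx => by
      have := hge x (Finset.mem_of_mem_erase (Finset.mem_of_mem_erase hx))
        (Finset.ne_of_mem_erase (Finset.mem_of_mem_erase hx))
      omega
  rw [hce, smul_eq_mul] at this
  have := hge i hi hij
  omega

/-- One agent takes a pair, three further agents share the remaining nine goods. -/
theorem solvable_of_pair [DecidableEq ι] {C V : Finset ι} {G : Finset ℕ} {k : ι → ℕ}
    (hk : ∀ b ∈ C, ∀ j < k b, I.Likes b {j}) (hk2 : ∀ b ∈ C, 2 ≤ k b) (hC : C.card = 6) {a : ι}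
    (ha : a ∈ C) {S : Finset ℕ} (hS : S ⊆ G) (hla : I.Likes a S) (hV : V ⊆ C.erase a)
    (hVc : V.card = 3) (hVs : I.Solvable V (G \ S)) (hG : Disjoint (Finset.Ico 0 2) G) :
    I.Solvable C (Finset.Ico 0 2 ∪ G) := by
  have hsub : insert a V ⊆ C := Finset.insert_subset ha (hV.trans (Finset.erase_subset _ _))
  have haV : a ∉ V := fun h => Finset.notMem_erase a C (hV h)
  have hW : (C \ insert a V).card = 2 := by
    rw [Finset.card_sdiff_of_subset hsub, Finset.card_insert_of_notMem haV, hC, hVc]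
  refine Solvable.of_sdiff hsub (hVs.insert hS hla) (solvable_singles (s := 0) (r := 2)
    (fun b hb => hk b (Finset.sdiff_subset hb)) hW fun b hb => ?_) hG.symm ?_
  · have := hk2 b (Finset.sdiff_subset hb)
    omega
  · rw [Finset.union_comm]

theorem solvable_of_pair_of_split [DecidableEq ι] {C V : Finset ι} {G : Finset ℕ} {k : ι → ℕ}
    (hk : ∀ b ∈ C, ∀ j < k b, I.Likes b {j}) (hk2 : ∀ b ∈ C, 2 ≤ k b) (hC : C.card = 6) {a : ι}
    (ha : a ∈ C) {S : Finset ℕ} (hS : S ⊆ G) (hla : I.Likes a S) (hV : V ⊆ C.erase a)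
    (hVc : 4 ≤ V.card) (h9 : (G \ S).card = 9) (hVs : ∀ b ∈ V, I.Split b 3 3 (G \ S))
    (hG : Disjoint (Finset.Ico 0 2) G) :
    I.Solvable C (Finset.Ico 0 2 ∪ G) := by
  obtain ⟨X, hX, hXc, hXs⟩ := exists_solvable_of_card_eq_nine hVc h9 fun b hb =>
    (hVs b hb).exists_division
  exact solvable_of_pair hk hk2 hC ha hS hla (hX.trans hV) hXc hXs hG

theorem isStart_Ico : IsStart (Finset.Ico 4 15) {4, 5, 6} 7 8 := by
  refine ⟨?_, by simp, by simp, by simp, by simp, ?_⟩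
  · decide
  · intro x hx hxT
    simp only [Finset.mem_Ico, Finset.mem_insert, Finset.mem_singleton] at hx hxT
    omega

theorem sum_card_filter_mem {C : Finset ι} {T : Finset ℕ} {D : ι → Finset ℕ}
    (hD : ∀ a ∈ C, D a ⊆ T) :
    ∑ τ ∈ T, (C.filter fun a => τ ∈ D a).card = ∑ a ∈ C, (D a).card := by
  have h1 := Finset.sum_card_bipartiteAbove_eq_sum_card_bipartiteBelow (s := T) (t := C)
    (r := fun τ a => τ ∈ D a)
  simp only [Finset.bipartiteAbove, Finset.bipartiteBelow] at h1
  rw [h1]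
  refine Finset.sum_congr rfl fun a ha => ?_
  rw [Finset.filter_mem_eq_inter, Finset.inter_eq_right.2 (hD a ha)]

theorem sum_card_le {C : Finset ι} {D : ι → Finset ℕ} (hD : ∀ a ∈ C, (D a).card ≤ 2) :
    ∑ a ∈ C, (D a).card ≤ C.card + (C.filter fun a => 1 < (D a).card).card := by
  rw [Finset.card_filter, Finset.card_eq_sum_ones, ← Finset.sum_add_distrib]
  refine Finset.sum_le_sum fun a ha => ?_
  have := hD a ha
  split_ifs <;> omega

theorem exists_card_filter_le {C : Finset ι} {T : Finset ℕ} {D : ι → Finset ℕ} {m : ℕ}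
    (hD : ∀ a ∈ C, D a ⊆ T) (h : ∑ a ∈ C, (D a).card < T.card * (m + 1)) :
    ∃ τ ∈ T, (C.filter fun a => τ ∈ D a).card ≤ m := by
  by_contra! hcon
  have : T.card • (m + 1) ≤ ∑ τ ∈ T, (C.filter fun a => τ ∈ D a).card :=
    Finset.card_nsmul_le_sum _ _ _ fun τ hτ => hcon τ hτ
  rw [sum_card_filter_mem hD, smul_eq_mul] at this
  omega

namespace Residual

variable {B : Finset ι} {k : ι → ℕ}

/-- The pair `{7, 8}` costs every other agent only one bundle, so three bundles on nine goods
remain. An agent with `k b = 1` has excess zero, hence four bundles of two goods; one of them avoids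
`{4, 5, 6}`, so she likes `{7, 8}`. The pair goes to such an agent if there is one. -/
theorem solvable_of_likes_start (h : I.Residual B k 4 4 4)
    (hd : ∃ d ∈ B, I.Likes d {7, 8}) :
    I.Solvable B (Finset.Ico 0 4 ∪ Finset.Ico 4 15) := by
  classical
  have hone : ∀ b ∈ B, k b = 1 → I.Likes b {7, 8} := by
    intro b hb hb1
    by_contra hl
    obtain ⟨D, -, hc, -⟩ := (h.split b hb).exists_pairSplit (h.needsTwo b hb) isStart_Ico hl
    rw [hb1] at hc
    simp at hc
  obtain ⟨d, hdB, hl, hdk⟩ : ∃ d ∈ B, I.Likes d {7, 8} ∧ (k d = 1 ∨ ∀ b ∈ B, k b ≠ 1) := by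
    by_cases h1 : ∃ b ∈ B, k b = 1
    · obtain ⟨b, hb, hb1⟩ := h1
      exact ⟨b, hb, hone b hb hb1, Or.inl hb1⟩
    · push Not at h1
      obtain ⟨d, hdB, hl⟩ := hd
      exact ⟨d, hdB, hl, Or.inr h1⟩
  set G' := Finset.Ico 4 15 \ {7, 8} with hG'
  have h9 : G'.card = 9 := by rw [hG']; decide
  have hGsub : ({7, 8} : Finset ℕ) ⊆ Finset.Ico 4 15 := by decide
  have hsp : ∀ b ∈ B, I.Split b 3 (k b - 1) G' := fun b hb =>
    (h.split b hb).sdiff_start isStart_Ico (by simp)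
  have hmem : ∀ x, x ∈ G' ↔ (4 ≤ x ∧ x < 15) ∧ x ≠ 7 ∧ x ≠ 8 := fun x => by
    rw [hG']; simp
  have hdc : (B.erase d).card = 7 := by rw [Finset.card_erase_of_mem hdB, h.card]
  suffices hs : I.Solvable (B.erase d) (Finset.Ico 0 4 ∪ G') by
    have := Solvable.insert (G := Finset.Ico 0 4 ∪ Finset.Ico 4 15) (S := {7, 8}) (hs.mono ?_)
      (hGsub.trans Finset.subset_union_right) hl
    · rwa [Finset.insert_erase hdB] at this
    · intro x hx
      simp only [Finset.mem_union, Finset.mem_sdiff, Finset.mem_Ico, Finset.mem_insert,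
        Finset.mem_singleton, hmem] at hx ⊢
      omega
  have hsub : ∀ b ∈ B.erase d, b ∈ B := fun b hb => Finset.mem_of_mem_erase hb
  by_cases hy : ∃ y ∈ B.erase d, k y = 1
  · obtain ⟨y, hyB, hy1⟩ := hy
    have hd1 : k d = 1 := hdk.resolve_right fun hne => hne y (hsub y hyB) hy1
    have hyc : ((B.erase d).erase y).card = 6 := by rw [Finset.card_erase_of_mem hyB, hdc]
    -- Both `d` and `y` like only good `0`, so removing them does not affect the counts for `j ≥ 1`.
    -- Thus `y`, whose bundles have no excess, stays for the tail.
    obtain ⟨X, hX, hXc, hXs⟩ := exists_solvable_singles (B := (B.erase d).erase y) (s := 0) (r := 4)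
      (fun b hb => h.likes b (hsub b (Finset.mem_of_mem_erase hb))) fun j hj => by
        rcases Nat.eq_zero_or_pos j with rfl | hj0
        · rw [Finset.filter_true_of_mem fun b hb => by
            have := h.one_le b (hsub b (Finset.mem_of_mem_erase hb))
            omega]
          omega
        · have := h.count j hj
          rw [Finset.filter_erase, Finset.filter_erase, Finset.erase_eq_of_notMem,
            Finset.erase_eq_of_notMem]
          · simp only [zero_add]
            omega
          · simp only [Finset.mem_filter]
            omega
          · simp only [Finset.mem_filter, Finset.mem_erase]
            omega
    have hXB := hX.trans (Finset.erase_subset _ _)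
    obtain ⟨P, hP, h1, h2⟩ := ((hsp y (hsub y hyB)).mono (E' := 1) (by omega)
      subset_rfl).exists_division_pairs
    refine Solvable.of_sdiff hXB hXs (exists_solvable_of_two_pairs (x := y) ?_ (fun a ha =>
      (hsp a (hsub a (Finset.sdiff_subset ha))).exists_division) ?_ hP (i := 1) (j := 2)
      (by decide) h1 h2) ?_ subset_rfl
    · rw [Finset.card_sdiff_of_subset hXB, hXc, hdc]
    · exact Finset.mem_sdiff.2 ⟨hyB, fun hyX => Finset.notMem_erase y _ (hX hyX)⟩
    · rw [Finset.disjoint_left]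
      intro x hx
      simp only [Finset.mem_Ico, hmem] at hx ⊢
      omega
  · push Not at hy
    obtain ⟨Z, hZ, hZc, hZs⟩ := exists_solvable_singles (B := B.erase d) (s := 2) (r := 2)
      (fun b hb => h.likes b (hsub b hb)) fun j hj => by
        have h1 := h.count (2 + j) (by omega)
        rw [Finset.filter_erase]
        have := Finset.pred_card_le_card_erase (s := B.filter fun b => 2 + j < k b) (a := d)
        omega
    have c1 : (B.erase d \ Z).card = 5 := by
      rw [Finset.card_sdiff_of_subset hZ, hZc, hdc]
    obtain ⟨X, hX, hXc, hXs⟩ := exists_solvable_of_card_eq_nine (A := B.erase d \ Z) (by omega) h9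
      fun a ha => (hsp a (hsub a (Finset.sdiff_subset ha))).exists_division
    have c2 : ((B.erase d \ Z) \ X).card = 2 := by
      rw [Finset.card_sdiff_of_subset hX, hXc, c1]
    have hW := solvable_singles (s := 0) (k := k) (fun b hb => h.likes b
      (hsub b (Finset.sdiff_subset (Finset.sdiff_subset hb)))) c2 fun b hb => by
        have hb := Finset.sdiff_subset (Finset.sdiff_subset hb)
        have h1 := hy b hb
        have h2 := h.one_le b (hsub b hb)
        omega
    refine Solvable.of_sdiff hZ hZs (Solvable.of_sdiff hX hXs hW ?_ subset_rfl) ?_ ?_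
    · rw [Finset.disjoint_left]
      intro x hx
      simp only [Finset.mem_Ico, hmem] at hx ⊢
      omega
    · rw [Finset.disjoint_left]
      intro x hx
      simp only [Finset.mem_Ico, Finset.mem_union, hmem] at hx ⊢
      omega
    · intro x hx
      simp only [Finset.mem_Ico, Finset.mem_union, hmem] at hx ⊢
      omega

/-- If nobody likes `{7, 8}`, bundles of two goods contain one of `4, 5, 6`. The plan is to give
goods `2, 3` to two agents `Z`, a pair `{τ, y}` with `τ` in `{4, 5, 6}` to a third, the remaining
nine tail goods to three more and goods `0, 1` to the last two. A good `τ` is bad for `a` if it lies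
in `D a`; agents with two bad goods are heavy. Heavy agents like all of `0, 1, 2, 3`, and their
bundles are one pair and three triples. -/
theorem solvable_of_eq_four (h : I.Residual B k 4 4 4) :
    I.Solvable B (Finset.Ico 0 4 ∪ Finset.Ico 4 15) := by
  classical
  by_cases hd : ∃ d ∈ B, I.Likes d {7, 8}
  · exact h.solvable_of_likes_start hd
  push Not at hd
  have hk2 : ∀ b ∈ B, 2 ≤ k b := by
    intro b hb
    by_contra hlt
    have h1 := h.one_le b hb
    obtain ⟨D, -, hc, -⟩ := (h.split b hb).exists_pairSplit (h.needsTwo b hb) isStart_Ico (hd b hb)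
    rw [show k b = 1 by omega] at hc
    simp at hc
  set G := Finset.Ico 4 15 with hG
  set T : Finset ℕ := {4, 5, 6} with hT
  have hTc : T.card = 3 := by simp [hT]
  have hTG : T ⊆ G := isStart_Ico.sub
  have hdata : ∀ a, ∃ D ⊆ T, D.card ≤ 2 ∧ (a ∈ B → (∀ τ ∈ T, τ ∉ D → I.PairSplit a 4 3 G τ) ∧
      (1 < D.card → 4 ≤ k a ∧ ∀ τ ∈ T, τ ∉ D → I.TripleSplit a G τ)) := by
    intro a
    by_cases ha : a ∈ B
    · have h4 := h.le_u a ha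
      obtain ⟨D, h1, h2, h3, h5⟩ := (h.split a ha).exists_pairSplit_or_tripleSplit (by omega)
        (h.needsTwo a ha) isStart_Ico hTc (hd a ha)
      exact ⟨D, h1, h2, fun _ => ⟨h3, fun hD => ⟨by have := (h5 hD).1; omega, (h5 hD).2⟩⟩⟩
    · exact ⟨∅, by simp, by simp, fun h => absurd h ha⟩
  choose D hDT hD2 hD using hdata
  -- six agents that remain after two agents took the goods `2` and `3`
  have finish : ∀ Z ⊆ B, Z.card = 2 → I.Solvable Z (Finset.Ico 2 4) →
      I.Solvable (B \ Z) (Finset.Ico 0 2 ∪ G) → I.Solvable B (Finset.Ico 0 4 ∪ G) := by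
    intro Z hZ hZc hZs hs
    refine Solvable.of_sdiff hZ hZs hs ?_ ?_
    · rw [Finset.disjoint_left]
      intro x hx
      simp only [hG, Finset.mem_Ico, Finset.mem_union] at hx ⊢
      omega
    · intro x hx
      simp only [hG, Finset.mem_Ico, Finset.mem_union] at hx ⊢
      omega
  have hdis : Disjoint (Finset.Ico 0 2) G := by
    rw [hG]; decide
  have pair : ∀ τ ∈ T, ∀ y ∈ G, y ≠ τ → {τ, y} ⊆ G ∧ (G \ {τ, y}).card = 9 := by
    intro τ hτ y hy hyτ
    have hS : {τ, y} ⊆ G := Finset.insert_subset (hTG hτ) (Finset.singleton_subset_iff.2 hy)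
    refine ⟨hS, ?_⟩
    rw [Finset.card_sdiff_of_subset hS, Finset.card_pair hyτ.symm, hG, Nat.card_Ico]
  set H := B.filter fun a => 1 < (D a).card with hH
  have hHB : H ⊆ B := Finset.filter_subset _ _
  have hHk : ∀ a ∈ H, 4 ≤ k a := fun a ha =>
    ((hD a (hHB ha)).2 (Finset.mem_filter.1 ha).2).1
  have heavy : ∀ Z ⊆ H, Z.card = 2 → I.Solvable Z (Finset.Ico 2 4) := fun Z hZ hZc =>
    solvable_singles (s := 2) (r := 2) (fun b hb => h.likes b (hHB (hZ hb))) hZc fun b hb =>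
      hHk b (hZ hb)
  by_cases hcase : 5 ≤ H.card ∧ ∃ τ ∈ T, 3 ≤ (H.filter fun a => τ ∉ D a).card
  · obtain ⟨hH5, τ, hτ, hτ3⟩ := hcase
    obtain ⟨Q, hQ, hQc⟩ := Finset.exists_subset_card_eq hτ3
    have hQH : Q ⊆ H := hQ.trans (Finset.filter_subset _ _)
    obtain ⟨Z, hZ, hZc⟩ := Finset.exists_subset_card_eq (s := H \ Q) (n := 2) (by
      rw [Finset.card_sdiff_of_subset hQH]; omega)
    have hZH : Z ⊆ H := hZ.trans Finset.sdiff_subset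
    refine finish Z (hZH.trans hHB) hZc (heavy Z hZH hZc) ?_
    have hC : (B \ Z).card = 6 := by
      rw [Finset.card_sdiff_of_subset (hZH.trans hHB), hZc, h.card]
    have hQC : Q ⊆ B \ Z := fun a ha => Finset.mem_sdiff.2 ⟨hHB (hQH ha), fun haZ =>
      (Finset.mem_sdiff.1 (hZ haZ)).2 ha⟩
    have hCB : ∀ a ∈ B \ Z, a ∈ B := fun a ha => Finset.sdiff_subset ha
    have hQD : ∀ a ∈ Q, τ ∉ D a := fun a ha => (Finset.mem_filter.1 (hQ ha)).2
    obtain ⟨a₀, ha₀⟩ : Q.Nonempty := Finset.card_pos.1 (by omega)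
    obtain ⟨y, hyG, hyτ, ⟨a, ha, hla⟩, hmax⟩ := exists_max_pair (I := I) (A := B \ Z) (G := G)
      (τ := τ) ⟨a₀, hQC ha₀, ((hD a₀ (hHB (hQH ha₀))).1 τ hτ (hQD a₀ ha₀)).exists_likes⟩
    obtain ⟨hS, h9⟩ := pair τ hτ y hyG hyτ
    -- If an agent outside `Q` takes the pair, the three agents of `Q` keep triples on nine goods.
    -- Otherwise everyone outside `Q` dislikes the pair, and all five agents who do not receive it
    -- retain three bundles.
    by_cases hh : ∃ b ∈ B \ Z, b ∉ Q ∧ I.Likes b {τ, y}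
    · obtain ⟨b, hb, hbQ, hlb⟩ := hh
      refine solvable_of_pair (fun b hb => h.likes b (hCB b hb)) (fun b hb => hk2 b (hCB b hb)) hC hb
        hS hlb (V := Q) (fun x hx => Finset.mem_erase.2 ⟨fun e => hbQ (e ▸ hx), hQC hx⟩) hQc
        (solvable_of_triples hQc h9 fun c hc => ?_) hdis
      exact (((hD c (hHB (hQH hc))).2 (Finset.mem_filter.1 (hQH hc)).2).2 τ hτ
        (hQD c hc)).exists_division h9 (hTG hτ) hyG (hmax c (hQC hc))
    · push Not at hh
      refine solvable_of_pair_of_split (fun b hb => h.likes b (hCB b hb))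
        (fun b hb => hk2 b (hCB b hb)) hC ha hS hla subset_rfl
        (by rw [Finset.card_erase_of_mem ha, hC]; norm_num) h9 (fun c hc => ?_) hdis
      have hc := Finset.mem_of_mem_erase hc
      by_cases hcQ : c ∈ Q
      · exact ((hD c (hCB c hc)).1 τ hτ (hQD c hcQ)).split (hTG hτ) hyG (hmax c hc)
      · exact ((h.split c (hCB c hc)).sdiff_pair (hh c hc hcQ)).mono
          (by have := h.le_u c (hCB c hc); omega) subset_rfl
  obtain ⟨Z, hZB, hZc, hZs, τ, hτ, hbad⟩ : ∃ Z ⊆ B, Z.card = 2 ∧ I.Solvable Z (Finset.Ico 2 4) ∧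
      ∃ τ ∈ T, ((B \ Z).filter fun a => τ ∈ D a).card ≤ 2 := by
    rcases Nat.lt_or_ge H.card 5 with hH5 | hH5
    -- With at most two heavy agents left among six, the bad incidences number at most `6 + 2 < 3 *
    -- 3`.
    · obtain ⟨Z, hZB, hZc, hZs, hZH⟩ : ∃ Z ⊆ B, Z.card = 2 ∧ I.Solvable Z (Finset.Ico 2 4) ∧
          (H \ Z).card ≤ 2 := by
        rcases Nat.lt_or_ge H.card 2 with hH2 | hH2
        · obtain ⟨Z, hZ, hZc, hZs⟩ := exists_solvable_singles (s := 2) (r := 2) h.likes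
            fun j hj => by
              have := h.count (2 + j) (by omega)
              omega
          exact ⟨Z, hZ, hZc, hZs, (Finset.card_le_card Finset.sdiff_subset).trans (by omega)⟩
        · obtain ⟨Z, hZ, hZc⟩ := Finset.exists_subset_card_eq hH2
          exact ⟨Z, hZ.trans hHB, hZc, heavy Z hZ hZc, by
            rw [Finset.card_sdiff_of_subset hZ]; omega⟩
      refine ⟨Z, hZB, hZc, hZs, exists_card_filter_le (fun a _ => hDT a) ?_⟩
      have h1 := sum_card_le (C := B \ Z) (D := D) fun a _ => hD2 a
      have h2 : ((B \ Z).filter fun a => 1 < (D a).card) = H \ Z := by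
        ext a; simp only [hH, Finset.mem_filter, Finset.mem_sdiff]; tauto
      rw [h2, Finset.card_sdiff_of_subset hZB, hZc, h.card] at h1
      omega
    · have hfew : ∀ τ ∈ T, (H.filter fun a => τ ∉ D a).card ≤ 2 := by
        intro τ hτ
        by_contra hlt
        exact hcase ⟨hH5, τ, hτ, by omega⟩
      have hmany : ∀ τ ∈ T, H.card ≤ (H.filter fun a => τ ∈ D a).card + 2 := fun τ hτ => by
        have h1 := hfew τ hτ
        have h2 := Finset.card_filter_add_card_filter_not (s := H) (fun a => τ ∈ D a)
        omega
      -- Each of the three goods is bad for all but two heavy agents, while a heavy agent has two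
      -- bad goods: `3 * (h - 2) ≤ 2 * h` for `h = H.card`. So there are at most `8 + 6 < 3 * 5` bad
      -- incidences and some `τ` is bad for at most four agents, two of whom can be sent away as
      -- heavy agents.
      have hH6 : H.card ≤ 6 := by
        have h1 : ∑ a ∈ H, (D a).card ≤ H.card • 2 := Finset.sum_le_card_nsmul _ _ _ fun a _ => hD2 a
        rw [← sum_card_filter_mem fun a _ => hDT a, hT, Finset.sum_insert (by simp),
          Finset.sum_pair (by simp), smul_eq_mul] at h1
        have := hmany 4 (by simp [hT])
        have := hmany 5 (by simp [hT])
        have := hmany 6 (by simp [hT])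
        omega
      obtain ⟨τ, hτ, hb4⟩ : ∃ τ ∈ T, (B.filter fun a => τ ∈ D a).card ≤ 4 := by
        refine exists_card_filter_le (fun a _ => hDT a) ?_
        have h1 := sum_card_le (C := B) (D := D) fun a _ => hD2 a
        rw [h.card, ← hH] at h1
        omega
      obtain ⟨Z, hZ, hZc⟩ := Finset.exists_subset_card_eq (s := H.filter fun a => τ ∈ D a) (n := 2)
        (by have := hmany τ hτ; omega)
      have hZH : Z ⊆ H := hZ.trans (Finset.filter_subset _ _)
      refine ⟨Z, hZH.trans hHB, hZc, heavy Z hZH hZc, τ, hτ, ?_⟩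
      have hZbad : Z ⊆ B.filter fun a => τ ∈ D a := fun a ha =>
        Finset.mem_filter.2 ⟨hHB (hZH ha), (Finset.mem_filter.1 (hZ ha)).2⟩
      have : (B \ Z).filter (fun a => τ ∈ D a) = (B.filter fun a => τ ∈ D a) \ Z := by
        ext a; simp only [Finset.mem_filter, Finset.mem_sdiff]; tauto
      rw [this, Finset.card_sdiff_of_subset hZbad, hZc]
      omega
  refine finish Z hZB hZc hZs ?_
  have hC : (B \ Z).card = 6 := by
    rw [Finset.card_sdiff_of_subset hZB, hZc, h.card]
  have hCB : ∀ a ∈ B \ Z, a ∈ B := fun a ha => Finset.sdiff_subset ha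
  have hgc : 4 ≤ ((B \ Z).filter fun a => τ ∉ D a).card := by
    have := Finset.card_filter_add_card_filter_not (s := B \ Z) (fun a => τ ∈ D a)
    omega
  obtain ⟨a₀, ha₀⟩ := Finset.card_pos.1 (by omega : 0 < ((B \ Z).filter fun a => τ ∉ D a).card)
  obtain ⟨ha₀C, ha₀D⟩ := Finset.mem_filter.1 ha₀
  obtain ⟨y, hyG, hyτ, ⟨a, ha, hla⟩, hmax⟩ := exists_max_pair (I := I) (A := B \ Z) (G := G)
    (τ := τ) ⟨a₀, ha₀C, ((hD a₀ (hCB _ ha₀C)).1 τ hτ ha₀D).exists_likes⟩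
  obtain ⟨hS, h9⟩ := pair τ hτ y hyG hyτ
  have good : ∀ c ∈ B \ Z, τ ∉ D c → I.Split c 3 3 (G \ {τ, y}) := fun c hc hcD =>
    ((hD c (hCB c hc)).1 τ hτ hcD).split (hTG hτ) hyG (hmax c hc)
  by_cases hh : ∃ b ∈ B \ Z, τ ∈ D b ∧ I.Likes b {τ, y}
  · obtain ⟨b, hb, hbD, hlb⟩ := hh
    refine solvable_of_pair_of_split (fun b hb => h.likes b (hCB b hb))
      (fun b hb => hk2 b (hCB b hb)) hC hb hS hlb (V := (B \ Z).filter fun a => τ ∉ D a)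
      (fun c hc => ?_) hgc h9 (fun c hc => ?_) hdis
    · obtain ⟨hc, hcD⟩ := Finset.mem_filter.1 hc
      exact Finset.mem_erase.2 ⟨fun e => hcD (e ▸ hbD), hc⟩
    · obtain ⟨hc, hcD⟩ := Finset.mem_filter.1 hc
      exact good c hc hcD
  · push Not at hh
    refine solvable_of_pair_of_split (fun b hb => h.likes b (hCB b hb))
      (fun b hb => hk2 b (hCB b hb)) hC ha hS hla subset_rfl
      (by rw [Finset.card_erase_of_mem ha, hC]; norm_num) h9 (fun c hc => ?_) hdis
    have hc := Finset.mem_of_mem_erase hc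
    by_cases hcD : τ ∈ D c
    · exact ((h.split c (hCB c hc)).sdiff_pair (hh c hc hcD)).mono
        (by have := h.le_u c (hCB c hc); omega) subset_rfl
    · exact good c hc hcD

end Residual

/-! ### Reduction to fifteen goods and to the residual problem. -/

theorem Likes.single_of_le {a : ι} {i j : ℕ} (h : I.Likes a {j}) (hij : i ≤ j) : I.Likes a {i} := by
  simp only [Likes, val, Finset.sum_singleton] at h ⊢
  exact h.trans (I.anti a hij)

theorem Likes.single_of_card_le_one {a : ι} {i : ℕ} {S : Finset ℕ} (h : I.Likes a S)
    (hS : S.card ≤ 1) (hi : ∀ g ∈ S, i ≤ g) : I.Likes a {i} := by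
  obtain ⟨x, hx⟩ := Finset.card_le_one_iff_subset_singleton.1 hS
  rcases S.eq_empty_or_nonempty with rfl | ⟨g, hg⟩
  · exact h.mono (by simp)
  · have hgx : g = x := by simpa using hx hg
    exact (h.mono hx).single_of_le (hgx ▸ hi g hg)

/-- The `s` best goods can be removed at the cost of `s` bundles. -/
theorem IsPacking.exists_remove_best {a : ι} {G J : Finset ℕ} {P : ℕ → Finset ℕ}
    (h : I.IsPacking a G J P) {s : ℕ} (hs : s ≤ J.card) :
    ∃ K ⊆ J, K.card = s ∧ ∀ j ∈ J \ K, ∀ g ∈ P j, s ≤ g := by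
  have hle : (J.filter fun j => ∃ g ∈ P j, g < s).card ≤ s := by
    have : ∀ j, ∃ g, j ∈ J.filter (fun j => ∃ g ∈ P j, g < s) → g ∈ P j ∧ g < s := fun j => by
      by_cases hj : j ∈ J.filter fun j => ∃ g ∈ P j, g < s
      · obtain ⟨g, hg⟩ := (Finset.mem_filter.1 hj).2
        exact ⟨g, fun _ => hg⟩
      · exact ⟨0, fun h => absurd h hj⟩
    choose φ hφ using this
    conv_rhs => rw [← Finset.card_range s]
    refine Finset.card_le_card_of_injOn φ (fun j hj => Finset.mem_range.2 (hφ j hj).2) ?_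
    intro i hi j hj hij
    by_contra hne
    exact Finset.disjoint_left.1 (h.disj i (Finset.mem_filter.1 hi).1 j (Finset.mem_filter.1 hj).1
      hne) (hφ i hi).1 (hij ▸ (hφ j hj).1)
  obtain ⟨K, h1, h2, h3⟩ := Finset.exists_subsuperset_card_eq (Finset.filter_subset _ J) hle hs
  refine ⟨K, h2, h3, fun j hj g hg => ?_⟩
  obtain ⟨hjJ, hjK⟩ := Finset.mem_sdiff.1 hj
  by_contra hlt
  exact hjK (h1 (Finset.mem_filter.2 ⟨hjJ, g, hg, by omega⟩))

theorem IsPacking.sum_card_le {a : ι} {G J : Finset ℕ} {P : ℕ → Finset ℕ}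
    (h : I.IsPacking a G J P) : ∑ j ∈ J, (P j).card ≤ G.card := by
  rw [← Finset.card_biUnion fun i hi j hj hij => h.disj i hi j hj hij]
  exact Finset.card_le_card (Finset.biUnion_subset.2 h.sub)

/-- An agent who likes only `k` single goods and not the empty set has few small bundles. -/
theorem IsPacking.two_mul_card_le {a : ι} {G J : Finset ℕ} {P : ℕ → Finset ℕ}
    (h : I.IsPacking a G J P) {k : ℕ} (hk : ¬ I.Likes a {k}) :
    2 * J.card ≤ ∑ j ∈ J, (P j).card + k := by
  -- A liked bundle of at most one good contains a good better than `k`; otherwise `{k}` would be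
  -- liked as well.
  have h1 : (J.filter fun j => (P j).card ≤ 1).card ≤ k := by
    have : ∀ j, ∃ g, j ∈ J.filter (fun j => (P j).card ≤ 1) → g ∈ P j ∧ g < k := fun j => by
      by_cases hj : j ∈ J.filter fun j => (P j).card ≤ 1
      · by_contra! hcon
        refine hk ((h.likes j (Finset.mem_filter.1 hj).1).single_of_card_le_one
          (Finset.mem_filter.1 hj).2 fun g hg => (hcon g).2 hg)
      · exact ⟨0, fun h => absurd h hj⟩
    choose φ hφ using this
    conv_rhs => rw [← Finset.card_range k]
    refine Finset.card_le_card_of_injOn φ (fun j hj => Finset.mem_range.2 (hφ j hj).2) ?_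
    intro i hi j hj hij
    by_contra hne
    exact Finset.disjoint_left.1 (h.disj i (Finset.mem_filter.1 hi).1 j (Finset.mem_filter.1 hj).1
      hne) (hφ i hi).1 (hij ▸ (hφ j hj).1)
  have h2 : ∀ j ∈ J, 1 ≤ (P j).card := fun j hj => by
    by_contra hlt
    have h0 : (P j) = ∅ := Finset.card_eq_zero.1 (by omega)
    exact hk ((h.likes j hj).mono (by simp [h0]))
  have h3 : ∑ j ∈ J, 2 ≤ ∑ j ∈ J, ((P j).card + if (P j).card ≤ 1 then 1 else 0) :=
    Finset.sum_le_sum fun j hj => by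
      have := h2 j hj
      split_ifs <;> omega
  rw [Finset.sum_add_distrib, ← Finset.card_filter, Finset.sum_const, smul_eq_mul] at h3
  omega

theorem exists_least_argmin (f : ℕ → ℕ) : ∃ u, (∀ j, f u ≤ f j) ∧ ∀ j < u, f u < f j := by
  classical
  have hex : ∃ u, ∀ j, f u ≤ f j := ⟨Function.argmin f, fun j => Function.argmin_le f j⟩
  refine ⟨Nat.find hex, Nat.find_spec hex, fun j hj => ?_⟩
  have := Nat.find_min hex hj
  push Not at this
  obtain ⟨i, hi⟩ := this
  exact (Nat.find_spec hex i).trans_lt hi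

/-- The cap `m` keeps `k a` finite for agents who like every single good. -/
theorem exists_count (I : OrderedInstance ι) (m : ℕ) :
    ∃ k : ι → ℕ, ∀ a, ∀ j, j < k a ↔ j < m ∧ I.Likes a {j} := by
  classical
  have hex : ∀ a, ∃ j, m ≤ j ∨ ¬ I.Likes a {j} := fun a => ⟨m, Or.inl le_rfl⟩
  refine ⟨fun a => Nat.find (hex a), fun a j => ⟨fun hj => ?_, fun hj => ?_⟩⟩
  · have := Nat.find_min (hex a) hj
    push Not at this
    exact this
  · by_contra hlt
    dsimp only at hlt
    rcases Nat.find_spec (hex a) with h1 | h1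
    · omega
    · exact h1 (hj.2.single_of_le (by omega))

theorem solvable_of_packings_fifteen {A : Finset ι} (hA : A.card = 8)
    (hP : ∀ a ∈ A, ∃ J P, I.IsPacking a (Finset.Ico 0 15) J P ∧ J.card = 8) :
    I.Solvable A (Finset.Ico 0 15) := by
  classical
  obtain ⟨k, hk⟩ := I.exists_count 15
  have hk1 : ∀ a ∈ A, 1 ≤ k a := by
    intro a ha
    obtain ⟨J, P, hJ, hc⟩ := hP a ha
    refine (hk a 0).2 ⟨by norm_num, ?_⟩
    by_contra h0
    have h1 := hJ.two_mul_card_le h0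
    have h2 := hJ.sum_card_le
    rw [Nat.card_Ico] at h2
    omega
  -- Minimality at `u` is the Hall-type condition that lets all agents with `k a > u` take single
  -- goods from `u` on. Strictness for `j < u` gives the others one agent to spare for the goods
  -- below `u`.
  obtain ⟨u, hmin, hlt⟩ := exists_least_argmin fun j => (A.filter fun a => j < k a).card + j
  set T := A.filter fun a => u < k a with hT
  set B := A.filter fun a => ¬ u < k a with hB
  have hTB : T.card + B.card = 8 := by rw [← hA]; exact Finset.card_filter_add_card_filter_not _
  have hBA : B ⊆ A := Finset.filter_subset _ _
  have ht8 : T.card + u ≤ 8 := by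
    have := hmin 0
    rw [Finset.filter_true_of_mem fun a ha => by have := hk1 a ha; omega, hA] at this
    exact this
  have hku : ∀ b ∈ B, k b ≤ u := fun b hb => not_lt.1 (Finset.mem_filter.1 hb).2
  have hdis : ∀ b ∈ B, ¬ I.Likes b {k b} := fun b hb hl =>
    absurd ((hk b (k b)).2 ⟨by have := hku b hb; omega, hl⟩) (lt_irrefl _)
  have hTs : I.Solvable T (Finset.Ico u (u + T.card)) := by
    obtain ⟨X, hX, hc, hs⟩ := exists_solvable_singles (I := I) (B := T) (s := u) (r := T.card)
      (k := k) (fun b _ j hj => ((hk b j).1 hj).2) fun j hj => by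
        have h1 := hmin (u + j)
        have h2 : T.filter (fun b => u + j < k b) = A.filter fun b => u + j < k b := by
          ext b
          simp only [hT, Finset.mem_filter]
          constructor
          · exact fun h => ⟨h.1.1, h.2⟩
          · exact fun h => ⟨⟨h.1, by omega⟩, h.2⟩
        rw [h2]
        omega
    rwa [Finset.eq_of_subset_of_card_le hX hc.ge] at hs
  have hneeds : ∀ b ∈ B, I.NeedsTwo b (Finset.Ico (u + T.card) 15) := by
    intro b hb S hS hl
    by_contra hlt
    refine hdis b hb (hl.single_of_card_le_one (by omega) fun g hg => ?_)
    have := Finset.mem_Ico.1 (hS hg)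
    have := hku b hb
    omega
  have hres : I.Residual B k (8 - (u + T.card)) u (u + T.card) := by
    refine ⟨by omega, fun b _ j hj => ((hk b j).1 hj).2, fun b hb => hk1 b (hBA hb), hku,
      fun j hj => ?_, fun b hb => ?_, hneeds⟩
    · have h1 := hlt j hj
      have h2 : (A.filter fun a => j < k a) = T ∪ B.filter fun a => j < k a := by
        ext a
        simp only [hT, hB, Finset.mem_union, Finset.mem_filter]
        by_cases hu : u < k a
        · simp [hu, hj.trans hu]
        · simp [hu]
      have h3 := Finset.card_union_le T (B.filter fun a => j < k a)
      rw [← h2] at h3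
      omega
    · obtain ⟨J, P, hJ, hc⟩ := hP b (hBA hb)
      obtain ⟨K, hKJ, hKc, hK⟩ := hJ.exists_remove_best (s := u + T.card) (by omega)
      have hpack : I.IsPacking b (Finset.Ico (u + T.card) 15) (J \ K) P := by
        have := hJ.mono subset_rfl (Finset.sdiff_subset (s := J) (t := K))
        refine ⟨fun j hj g hg => ?_, this.disj, this.likes⟩
        have h1 := hK j hj g hg
        have h2 := Finset.mem_Ico.1 (this.sub j hj hg)
        rw [Finset.mem_Ico]
        omega
      have hcJK : (J \ K).card = 8 - (u + T.card) := by
        rw [Finset.card_sdiff_of_subset hKJ, hc, hKc]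
      refine ⟨J \ K, P, hpack, hcJK, ?_⟩
      -- With `t = u + T.card`, the `t` dropped bundles contain at least `2 * t - k b` of the
      -- fifteen goods. The `8 - t` kept ones thus have at most `15 - 2 * t + k b` goods, an excess
      -- of at most `k b - 1`.
      have h1 := (hJ.mono subset_rfl hKJ).two_mul_card_le (hdis b hb)
      have h2 := hJ.sum_card_le
      rw [Nat.card_Ico, ← Finset.sum_sdiff hKJ] at h2
      have h3 : ∑ j ∈ J \ K, ((P j).card - 2) + ∑ j ∈ J \ K, 2 = ∑ j ∈ J \ K, (P j).card := by
        rw [← Finset.sum_add_distrib]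
        refine Finset.sum_congr rfl fun j hj => ?_
        have := hneeds b hb _ (hpack.sub j hj) (hpack.likes j hj)
        omega
      rw [Finset.sum_const, hcJK, smul_eq_mul] at h3
      have := hk1 b (hBA hb)
      omega
  have hBs : I.Solvable B (Finset.Ico 0 u ∪ Finset.Ico (u + T.card) 15) := by
    by_cases h2 : 8 - (u + T.card) ≤ 2
    · exact hres.solvable_of_le_two (by omega) h2
    by_cases h3 : u ≤ 3
    · exact hres.solvable_of_u_le_three (by omega) h3
    -- Here `4 ≤ u ≤ u + T.card ≤ 5`.
    rcases (by omega : u + T.card = 4 ∨ u + T.card = 5) with ht | ht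
    · have hu : u = 4 := by omega
      rw [ht] at hres ⊢
      rw [hu] at hres ⊢
      exact hres.solvable_of_eq_four
    · rw [ht] at hres ⊢
      exact hres.solvable_of_eq_three (by omega)
  refine Solvable.of_sdiff (Finset.filter_subset _ A) hTs (H := Finset.Ico 0 u ∪
    Finset.Ico (u + T.card) 15) ?_ ?_ ?_
  · rwa [hT, ← Finset.filter_not]
  · rw [Finset.disjoint_left]
    intro x hx
    simp only [Finset.mem_Ico, Finset.mem_union] at hx ⊢
    omega
  · intro x hx
    simp only [Finset.mem_Ico, Finset.mem_union] at hx ⊢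
    omega

/-- The instance without the `s` best goods. -/
def shift (I : OrderedInstance ι) (s : ℕ) : OrderedInstance ι where
  v a g := I.v a (g + s)
  mu := I.mu
  nonneg a g := I.nonneg a (g + s)
  anti a := fun _ _ h => I.anti a (Nat.add_le_add_right h s)

theorem shift_likes {a : ι} {s : ℕ} {S : Finset ℕ} :
    (I.shift s).Likes a S ↔ I.Likes a (S.map (addRightEmbedding s)) := by
  simp [Likes, val, shift]

theorem Solvable.of_shift {A : Finset ι} {G : Finset ℕ} {s : ℕ} (h : (I.shift s).Solvable A G) :
    I.Solvable A (G.map (addRightEmbedding s)) := by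
  obtain ⟨f, hf, hd⟩ := h
  refine ⟨fun a => (f a).map (addRightEmbedding s), fun a ha =>
    ⟨Finset.map_subset_map.2 (hf a ha).1, shift_likes.1 (hf a ha).2⟩, fun a ha b hb hab => ?_⟩
  exact (Finset.disjoint_map _).2 (hd ha hb hab)

/-- Agents who can each split `n + 7` goods into `n` liked bundles can all be satisfied. -/
theorem solvable_of_packings {n : ℕ} (hn : 8 ≤ n) {A : Finset ι} (hA : A.card = n)
    (hP : ∀ a ∈ A, ∃ J P, I.IsPacking a (Finset.range (n + 7)) J P ∧ J.card = n) :
    I.Solvable A (Finset.range (n + 7)) := by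
  classical
  obtain ⟨s, rfl⟩ : ∃ s, n = s + 8 := ⟨n - 8, by omega⟩
  obtain ⟨X, hX, hXc⟩ := Finset.exists_subset_card_eq (by omega : s ≤ A.card)
  have hlike : ∀ a ∈ A, I.Likes a {s} := by
    intro a ha
    obtain ⟨J, P, hJ, hc⟩ := hP a ha
    by_contra hs
    have h1 := hJ.two_mul_card_le hs
    have h2 := hJ.sum_card_le
    rw [Finset.card_range] at h2
    omega
  have h1 : I.Solvable X (Finset.Ico 0 (0 + s)) := solvable_singles (k := fun _ => s)
    (fun b hb j hj => (hlike b (hX hb)).single_of_le hj.le) hXc fun b _ => by omega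
  have h2 : (I.shift s).Solvable (A \ X) (Finset.Ico 0 15) := by
    refine solvable_of_packings_fifteen (by rw [Finset.card_sdiff_of_subset hX]; omega) ?_
    intro a ha
    obtain ⟨J, P, hJ, hc⟩ := hP a (Finset.sdiff_subset ha)
    obtain ⟨K, hKJ, hKc, hK⟩ := hJ.exists_remove_best (s := s) (by omega)
    have hmap : ∀ j ∈ J \ K, ((P j).image (· - s)).map (addRightEmbedding s) = P j := by
      intro j hj
      ext g
      simp only [Finset.mem_map, Finset.mem_image, addRightEmbedding_apply]
      constructor
      · rintro ⟨x, ⟨y, hy, rfl⟩, rfl⟩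
        have := hK j hj y hy
        rwa [Nat.sub_add_cancel this]
      · intro hg
        exact ⟨g - s, ⟨g, hg, rfl⟩, Nat.sub_add_cancel (hK j hj g hg)⟩
    refine ⟨J \ K, fun j => (P j).image (· - s), ⟨fun j hj x hx => ?_, fun i hi j hj hij => ?_,
      fun j hj => ?_⟩, by rw [Finset.card_sdiff_of_subset hKJ]; omega⟩
    · obtain ⟨y, hy, rfl⟩ := Finset.mem_image.1 hx
      have h1 := Finset.mem_range.1 (hJ.sub j (Finset.sdiff_subset hj) hy)
      rw [Finset.mem_Ico]
      omega
    · rw [← Finset.disjoint_map (addRightEmbedding s), hmap i hi, hmap j hj]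
      exact hJ.disj i (Finset.sdiff_subset hi) j (Finset.sdiff_subset hj) hij
    · rw [shift_likes, hmap j hj]
      exact hJ.likes j (Finset.sdiff_subset hj)
  refine Solvable.of_sdiff hX h1 h2.of_shift ?_ ?_
  · rw [Finset.disjoint_left]
    intro x hx
    simp only [Finset.mem_Ico, Finset.mem_map, addRightEmbedding_apply] at hx ⊢
    omega
  · intro x hx
    simp only [Finset.mem_Ico, Finset.mem_union, Finset.mem_map, addRightEmbedding_apply,
      Finset.mem_range] at hx ⊢
    omega

end OrderedInstance

/-! ### From arbitrary instances to ordered ones. -/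

namespace GoodsInstance

variable {n m : ℕ} (I : GoodsInstance n m)

/-- Agent `i`'s ranking of the goods, the best one first. -/
noncomputable def ranking (i : Fin n) : Equiv.Perm (Fin m) := Tuple.sort fun g => -I.val i {g}

theorem val_ranking_anti (i : Fin n) {k l : Fin m} (h : k ≤ l) :
    I.val i {I.ranking i l} ≤ I.val i {I.ranking i k} := by
  have := Tuple.monotone_sort (fun g => -I.val i {g}) h
  simpa [ranking] using this

/-- The instance in which every agent's `j`-th good is worth what her `j`-th best good is worth. -/
noncomputable def ordered : OrderedInstance (Fin n) where
  v i j := if h : j < m then I.val i {I.ranking i ⟨j, h⟩} else 0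
  mu := I.mms
  nonneg i j := by
    split_ifs
    · exact I.nonneg _ _
    · exact le_rfl
  anti i j k h := by
    dsimp only
    split_ifs with h1 h2
    · exact I.val_ranking_anti i h
    · omega
    · exact I.nonneg _ _
    · exact le_rfl

theorem ordered_v (i : Fin n) (l : Fin m) : I.ordered.v i l = I.val i {I.ranking i l} := by
  simp [ordered]

theorem exists_packing (i : Fin n) :
    ∃ J P, I.ordered.IsPacking i (Finset.range m) J P ∧ J.card = n := by
  obtain ⟨⟨A, hA⟩, -⟩ := I.isGreatest_mms i
  let P : Fin n → Finset ℕ := fun j =>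
    ((A.bundle j).map (I.ranking i).symm.toEmbedding).map Fin.valEmbedding
  have hP : ∀ j, I.ordered.val i (P j) = I.val i (A.bundle j) := by
    intro j
    rw [I.additive i, OrderedInstance.val, Finset.sum_map, Finset.sum_map]
    refine Finset.sum_congr rfl fun g _ => ?_
    simp [ordered_v]
  refine ⟨Finset.range n, fun j => if h : j < n then P ⟨j, h⟩ else ∅, ⟨?_, ?_, ?_⟩,
    Finset.card_range n⟩
  · intro j hj x hx
    simp only [Finset.mem_range.1 hj, dif_pos] at hx
    obtain ⟨y, -, rfl⟩ := Finset.mem_map.1 hx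
    exact Finset.mem_range.2 y.2
  · intro j hj k hk hjk
    simp only [Finset.mem_range.1 hj, Finset.mem_range.1 hk, dif_pos]
    refine (Finset.disjoint_map _).2 ((Finset.disjoint_map _).2 (A.disjoint _ _ ?_))
    simpa using hjk
  · intro j hj
    simp only [Finset.mem_range.1 hj, dif_pos]
    rw [OrderedInstance.Likes, hP]
    exact hA.2 ⟨_, rfl⟩

/-- Letting the owners of the positions `0, 1, 2, …` choose the good of that position, an agent
obtains at least the value of her positions. -/
theorem exists_pick (owner : Fin m → Fin n) :
    ∃ pick : Fin m → Fin m, Function.Bijective pick ∧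
      ∀ l, I.ordered.v (owner l) l ≤ I.val (owner l) {pick l} := by
  classical
  let t : Fin m → Finset (Fin m) := fun l =>
    (Finset.Iic l).map (I.ranking (owner l)).toEmbedding
  -- Hall's condition holds because the last position of `s` alone admits as many goods as there are
  -- positions up to it.
  have hall : ∀ s : Finset (Fin m), s.card ≤ (s.biUnion t).card := by
    intro s
    rcases s.eq_empty_or_nonempty with rfl | hs
    · simp
    · have hmax := s.max'_mem hs
      calc s.card ≤ (Finset.Iic (s.max' hs)).card :=
            Finset.card_le_card fun x hx => Finset.mem_Iic.2 (s.le_max' x hx)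
        _ = (t (s.max' hs)).card := (Finset.card_map _).symm
        _ ≤ (s.biUnion t).card := Finset.card_le_card (Finset.subset_biUnion_of_mem t hmax)
  obtain ⟨pick, hinj, hpick⟩ := (Finset.all_card_le_biUnion_card_iff_exists_injective t).1 hall
  refine ⟨pick, Finite.injective_iff_bijective.1 hinj, fun l => ?_⟩
  obtain ⟨k, hk, he⟩ := Finset.mem_map.1 (hpick l)
  rw [ordered_v, ← he]
  exact I.val_ranking_anti _ (Finset.mem_Iic.1 hk)

theorem exists_isMMSAllocation_of_solvable (i₀ : Fin n)
    (h : I.ordered.Solvable Finset.univ (Finset.range m)) :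
    ∃ A : Allocation n m, I.IsMMSAllocation A := by
  classical
  obtain ⟨f, hf, hd⟩ := h
  have : ∀ l : Fin m, ∃ a, ∀ b, (l : ℕ) ∈ f b → b = a := by
    intro l
    by_cases hl : ∃ a, (l : ℕ) ∈ f a
    · obtain ⟨a, ha⟩ := hl
      refine ⟨a, fun b hb => ?_⟩
      by_contra hab
      exact Finset.disjoint_left.1 (hd (by simp) (by simp) hab) hb ha
    · push Not at hl
      -- Unassigned positions go to `i₀`: an allocation must cover all goods, and extra goods do no
      -- harm.
      exact ⟨i₀, fun b hb => absurd hb (hl b)⟩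
  choose owner howner using this
  obtain ⟨pick, hbij, hpick⟩ := I.exists_pick owner
  refine ⟨⟨fun a => (Finset.univ.filter fun l => owner l = a).map ⟨pick, hbij.1⟩, ?_, ?_⟩, ?_⟩
  · intro a b hab
    refine (Finset.disjoint_map _).2 (Finset.disjoint_left.2 fun l hl hl' => hab ?_)
    exact (Finset.mem_filter.1 hl).2.symm.trans (Finset.mem_filter.1 hl').2
  · intro g
    obtain ⟨l, rfl⟩ := hbij.2 g
    exact ⟨owner l, Finset.mem_map.2 ⟨l, by simp, rfl⟩⟩
  · intro a
    obtain ⟨hsub, hl⟩ := hf a (Finset.mem_univ a)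
    refine hl.trans ?_
    rw [I.additive a, Finset.sum_map]
    calc I.ordered.val a (f a)
        ≤ I.ordered.val a ((Finset.univ.filter fun l => owner l = a).map Fin.valEmbedding) := by
          refine OrderedInstance.val_mono fun x hx => ?_
          have hxm := Finset.mem_range.1 (hsub hx)
          exact Finset.mem_map.2 ⟨⟨x, hxm⟩, Finset.mem_filter.2 ⟨Finset.mem_univ _,
            (howner ⟨x, hxm⟩ a hx).symm⟩, rfl⟩
      _ = ∑ l ∈ Finset.univ.filter (fun l => owner l = a), I.ordered.v a l := by
          rw [OrderedInstance.val, Finset.sum_map]; rfl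
      _ ≤ _ := Finset.sum_le_sum fun l hl => by
          have := hpick l
          rw [(Finset.mem_filter.1 hl).2] at this
          exact this

end GoodsInstance

theorem theorem3 (n m : ℕ) (hn : 8 ≤ n) (hm : m = n + 7) (I : GoodsInstance n m) :
    ∃ A : Allocation n m, I.IsMMSAllocation A := by
  subst hm
  exact I.exists_isMMSAllocation_of_solvable ⟨0, by omega⟩ <| OrderedInstance.solvable_of_packings hn
    (by simp) fun i _ => I.exists_packing i
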